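/- Let $N\ge 0$ and $\beta\ge 0$ be integers and let $\gamma>-1/2$ be real. On $\mathbb{C}[z]=\mathbb{C}[z_1,\dots,z_N]$ let $s_{jk}$ exchange $z_j$ and $z_k$, let $t_j$ replace $z_j$ by $-z_j$, and put $$D_j=\frac{\partial}{\partial z_j}+\beta\sum_{k\ne j}\Big(\frac{1-s_{jk}}{z_j-z_k}+\frac{1-t_jt_ks_{jk}}{z_j+z_k}\Big)+\gamma\,\frac{1-t_j}{z_j},$$ $$\tilde b_j^\dagger=\tfrac{1}{\sqrt2}(-D_j+2z_j),\qquad \tilde b_j=\tfrac1{\sqrt2}D_j,\qquad \tilde h_j=\tilde b_j^\dagger\tilde b_j+\beta\sum_{k<j}(s_{jk}+t_jt_ks_{jk})$$ (the operators $\tilde h_j$ commute pairwise), and $$\mathcal X_L=\prod_{i<j}(z_i^2-z_j^2),\quad \mathcal Y_L=\prod_{i<j}\big(\beta+\tfrac12\tilde h_i-\tfrac12\tilde h_j\big),\quad \hat{\mathcal Y}_L=\prod_{i<j}\big(-\beta+\tfrac12\tilde h_i-\tfrac12\tilde h_j\big).$$ The shift operators are $G_L=\mathcal X_L^{-1}\mathcal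 Y_L$ and $\hat G_L=\hat{\mathcal Y}_L\mathcal X_L$ (all formed with the parameters $\beta,\gamma$). A partition is a sequence $\lambda_1\ge\dots\ge\lambda_N\ge0$ of integers, $m_\lambda$ is the monomial symmetric polynomial in $N$ variables, and $\mu<\lambda$ means that $\mu\neq\lambda$ and $\mu_1+\dots+\mu_k\le\lambda_1+\dots+\lambda_k$ for $k=1,\dots,N$ (the weights need not be equal). Let $$\langle f,g\rangle^{(\beta)}=\int_{\mathbb{R}^N} f(z)g(z)\prod_{j<k}|z_j^2-z_k^2|^{2\beta}\prod_{j=1}^N|z_j|^{2\gamma}e^{-z_j^2}\,dz .$$ The multivariable Laguerre polynomial $L^{(\beta)}_\lambda$ is the unique polynomial such that (i) $L^{(\beta)}_\lambda(z)=m_\lambda(z^2)+\sum_{\mu<\lambda}u_{\lambda\mu}m_\mu(z^2)$ for some $u_{\lambda\mu}\in\mathbb{C}$, where $z^2=(z_1^2,\dots,z_N^2)$, and (ii) $\langle L^{(\beta)}_\lambda,m_\mu(z^2)\rangle^{(\beta)}=0$ for all partitions $\mu<\lambda$. Then, with $\delta=(N-1,N-2,\dots,0)$, for every partition $\lambda$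 the polynomials $L^{(\beta)}_{\lambda+\delta}$ and $L^{(\beta+1)}_\lambda$ exist, are unique, and satisfy the shift relations $$G_L\,L^{(\beta)}_{\lambda+\delta}=c^{(\beta+1)}_\lambda L^{(\beta+1)}_\lambda,\qquad \hat G_L\,L^{(\beta+1)}_\lambda=\tilde c^{(\beta+1)}_\lambda L^{(\beta)}_{\lambda+\delta},$$ where $$c^{(\beta+1)}_\lambda=\prod_{1\le i<j\le N}\{\lambda_{N-j+1}-\lambda_{N-i+1}+j-i+\beta(j-i-1)\},$$ $$\tilde c^{(\beta+1)}_\lambda=\prod_{1\le i<j\le N}\{\lambda_{N-j+1}-\lambda_{N-i+1}+j-i+\beta(j-i+1)\}.$$ -/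

import Mathlib

open MvPolynomial MeasureTheory

noncomputable section

namespace CalogeroB

/-- The polynomial ring `ℂ[z_1, …, z_N]` (variables are indexed from `0`). -/
abbrev Poly (N : ℕ) : Type := MvPolynomial (Fin N) ℂ

/-! ### The Weyl group of type `B_N` acting on polynomials, and divided differences -/

/-- `s_{jk}`: exchanges the variables `z_j` and `z_k`. -/
def sAlg {N : ℕ} (j k : Fin N) : Poly N →ₐ[ℂ] Poly N :=
  rename (Equiv.swap j k)

/-- `t_j`: replaces `z_j` by `-z_j`. -/
def tAlg {N : ℕ} (j : Fin N) : Poly N →ₐ[ℂ] Poly N :=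
  aeval (Function.update X j (-X j))

/-- `s_{jk}` as a linear operator. -/
def s {N : ℕ} (j k : Fin N) : Module.End ℂ (Poly N) := (sAlg j k).toLinearMap

/-- `t_j` as a linear operator. -/
def t {N : ℕ} (j : Fin N) : Module.End ℂ (Poly N) := (tAlg j).toLinearMap

/-- The operator `d⁻¹ ∘ T`, for a nonzero polynomial `d` that divides every value of `T`
(and `0` if there is no such divisibility). -/
def exactQuot {N : ℕ} (d : Poly N) (T : Module.End ℂ (Poly N)) : Module.End ℂ (Poly N) :=
  open Classical in
  if h : d ≠ 0 ∧ ∀ f, d ∣ T f then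
    { toFun := fun f => (h.2 f).choose
      map_add' := fun f g => mul_left_cancel₀ h.1 (by
        rw [mul_add, ← (h.2 f).choose_spec, ← (h.2 g).choose_spec,
          ← (h.2 (f + g)).choose_spec, map_add])
      map_smul' := fun c f => mul_left_cancel₀ h.1 (by
        rw [RingHom.id_apply, mul_smul_comm, ← (h.2 f).choose_spec,
          ← (h.2 (c • f)).choose_spec, map_smul]) }
  else 0

theorem mul_exactQuot {N : ℕ} {d : Poly N} {T : Module.End ℂ (Poly N)} (hd : d ≠ 0)
    (hT : ∀ f, d ∣ T f) (f : Poly N) : d * exactQuot d T f = T f := by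
  have h : d ≠ 0 ∧ ∀ f, d ∣ T f := ⟨hd, hT⟩
  rw [exactQuot, dif_pos h]
  exact (h.2 f).choose_spec.symm

theorem dvd_sub_algHom {N : ℕ} (d : Poly N) (σ : Poly N →ₐ[ℂ] Poly N)
    (h : ∀ i, d ∣ X i - σ (X i)) (f : Poly N) : d ∣ f - σ f := by
  have key : Ideal.Quotient.mkₐ ℂ (Ideal.span {d}) =
      (Ideal.Quotient.mkₐ ℂ (Ideal.span {d})).comp σ := by
    refine algHom_ext fun i => ?_
    simp only [AlgHom.comp_apply, Ideal.Quotient.mkₐ_eq_mk]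
    rw [Ideal.Quotient.eq, Ideal.mem_span_singleton]
    exact h i
  have h2 := DFunLike.congr_fun key f
  simp only [AlgHom.comp_apply, Ideal.Quotient.mkₐ_eq_mk] at h2
  rwa [Ideal.Quotient.eq, Ideal.mem_span_singleton] at h2

/-- `(1 - s_{jk}) / (z_j - z_k)`. -/
def diffMinus {N : ℕ} (j k : Fin N) : Module.End ℂ (Poly N) :=
  exactQuot (X j - X k) (1 - s j k)

/-- `(1 - t_j t_k s_{jk}) / (z_j + z_k)`. -/
def diffPlus {N : ℕ} (j k : Fin N) : Module.End ℂ (Poly N) :=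
  exactQuot (X j + X k) (1 - t j * t k * s j k)

/-- `(1 - t_j) / z_j`. -/
def diffSign {N : ℕ} (j : Fin N) : Module.End ℂ (Poly N) :=
  exactQuot (X j) (1 - t j)

theorem mul_diffMinus {N : ℕ} {j k : Fin N} (hjk : j ≠ k) (f : Poly N) :
    (X j - X k) * diffMinus j k f = f - s j k f := by
  refine mul_exactQuot ?_ (dvd_sub_algHom _ (sAlg j k) fun i => ?_) f
  · rw [sub_ne_zero]
    exact fun h => hjk (X_injective h)
  · simp only [sAlg, rename_X]
    by_cases h1 : i = j
    · subst h1
      simp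
    · by_cases h2 : i = k
      · subst h2
        simpa using (dvd_sub_comm.mp (dvd_refl (X j - X i : Poly N)))
      · simp [Equiv.swap_apply_of_ne_of_ne h1 h2]

theorem mul_diffPlus {N : ℕ} {j k : Fin N} (hjk : j ≠ k) (f : Poly N) :
    (X j + X k) * diffPlus j k f = f - t j (t k (s j k f)) := by
  refine mul_exactQuot ?_
    (dvd_sub_algHom _ ((tAlg j).comp ((tAlg k).comp (sAlg j k))) fun i => ?_) f
  · intro h
    have h1 := congrArg (eval (Pi.single j (1 : ℂ))) h
    simp [hjk.symm] at h1
  · simp only [sAlg, tAlg, AlgHom.comp_apply, rename_X, aeval_X]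
    by_cases h1 : i = j
    · subst h1
      simp [hjk.symm]
    · by_cases h2 : i = k
      · subst h2
        simp [hjk, add_comm]
      · simp [Equiv.swap_apply_of_ne_of_ne h1 h2, h1, h2]

theorem mul_diffSign {N : ℕ} (j : Fin N) (f : Poly N) :
    X j * diffSign j f = f - t j f := by
  refine mul_exactQuot (X_ne_zero j) (dvd_sub_algHom _ (tAlg j) fun i => ?_) f
  simp only [tAlg, aeval_X]
  by_cases h1 : i = j
  · subst h1
    simp
  · simp [h1]

/-! ### Dunkl-type operators -/

/-- The Dunkl operator of type `B_N`,
`D_j = ∂/∂z_j + β ∑_{k ≠ j} ((1 - s_{jk})/(z_j - z_k) + (1 - t_j t_k s_{jk})/(z_j + z_k))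
  + γ (1 - t_j)/z_j`. -/
def dunkl {N : ℕ} (β : ℕ) (γ : ℝ) (j : Fin N) : Module.End ℂ (Poly N) :=
  (pderiv j).toLinearMap
    + (β : ℂ) • ∑ k ∈ Finset.univ.filter (fun k => k ≠ j), (diffMinus j k + diffPlus j k)
    + (γ : ℂ) • diffSign j

/-- Multiplication by the polynomial `p`. -/
def mulOp {N : ℕ} (p : Poly N) : Module.End ℂ (Poly N) := LinearMap.mulLeft ℂ p

/-- The gauge-transformed creation operator `(-D_j + 2 z_j) / √2`. -/
def creation {N : ℕ} (β : ℕ) (γ : ℝ) (j : Fin N) : Module.End ℂ (Poly N) :=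
  ((Real.sqrt 2 : ℝ) : ℂ)⁻¹ • (-dunkl β γ j + (2 : ℂ) • mulOp (X j))

/-- The gauge-transformed annihilation operator `D_j / √2`. -/
def annihilation {N : ℕ} (β : ℕ) (γ : ℝ) (j : Fin N) : Module.End ℂ (Poly N) :=
  ((Real.sqrt 2 : ℝ) : ℂ)⁻¹ • dunkl β γ j

/-- The commuting operators `h_j = b_j† b_j + β ∑_{k < j} (s_{jk} + t_j t_k s_{jk})`. -/
def h {N : ℕ} (β : ℕ) (γ : ℝ) (j : Fin N) : Module.End ℂ (Poly N) :=
  creation β γ j * annihilation β γ j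
    + (β : ℂ) • ∑ k ∈ Finset.univ.filter (fun k => k < j), (s j k + t j * t k * s j k)

/-! ### Shift operators -/

/-- The pairs `(i, j)` with `i < j`, in lexicographic order. -/
def pairs (N : ℕ) : List (Fin N × Fin N) :=
  (List.finRange N ×ˢ List.finRange N).filter (fun p => p.1 < p.2)

/-- `∏_{i<j} (c + h_i / 2 - h_j / 2)`, a composition of (pairwise commuting) operators. -/
def yProd (N : ℕ) (β : ℕ) (γ : ℝ) (c : ℂ) : Module.End ℂ (Poly N) :=
  ((pairs N).map fun p =>
    c • (1 : Module.End ℂ (Poly N)) + (1 / 2 : ℂ) • h β γ p.1 - (1 / 2 : ℂ) • h β γ p.2).prod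

/-- `𝒴_L = ∏_{i<j} (β + h_i / 2 - h_j / 2)`. -/
def opY (N : ℕ) (β : ℕ) (γ : ℝ) : Module.End ℂ (Poly N) := yProd N β γ (β : ℂ)

/-- `𝒴̂_L = ∏_{i<j} (-β + h_i / 2 - h_j / 2)`. -/
def opYhat (N : ℕ) (β : ℕ) (γ : ℝ) : Module.End ℂ (Poly N) := yProd N β γ (-(β : ℂ))

/-- `𝒳_L = ∏_{i<j} (z_i² - z_j²)`. -/
def polyX (N : ℕ) : Poly N :=
  ∏ p ∈ Finset.univ.filter (fun p : Fin N × Fin N => p.1 < p.2), (X p.1 ^ 2 - X p.2 ^ 2)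

/-- `G_L = 𝒳_L⁻¹ 𝒴_L`, with values in the field of rational functions. -/
def shiftG (N : ℕ) (β : ℕ) (γ : ℝ) (f : Poly N) : FractionRing (Poly N) :=
  (algebraMap (Poly N) (FractionRing (Poly N)) (polyX N))⁻¹ *
    algebraMap (Poly N) (FractionRing (Poly N)) (opY N β γ f)

/-- `Ĝ_L = 𝒴̂_L 𝒳_L`. -/
def shiftGhat (N : ℕ) (β : ℕ) (γ : ℝ) : Module.End ℂ (Poly N) :=
  opYhat N β γ * mulOp (polyX N)

/-! ### Multivariable Laguerre polynomials

Partitions with at most `N` parts are the antitone functions `Fin N → ℕ`. -/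

/-- The monomial symmetric polynomial `m_μ`: the sum of the distinct monomials whose exponent
vector is a rearrangement of `μ`. -/
def mSymm {N : ℕ} (μ : Fin N → ℕ) : Poly N :=
  ∑ α ∈ Finset.univ.image (fun w : Equiv.Perm (Fin N) => μ ∘ w), ∏ i, X i ^ α i

/-- `m_μ(z²) = m_μ(z_1², …, z_N²)`. -/
def mSq {N : ℕ} (μ : Fin N → ℕ) : Poly N := expand 2 (mSymm μ)

/-- Strict dominance order on partitions with at most `N` parts, not necessarily of equal
weight: all partial sums of `μ` are at most those of `lam`, and `μ ≠ lam`. -/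
def DomLT {N : ℕ} (μ lam : Fin N → ℕ) : Prop :=
  (∀ k : Fin N, ∑ i ∈ Finset.Iic k, μ i ≤ ∑ i ∈ Finset.Iic k, lam i) ∧ μ ≠ lam

/-- The ground state `∏_{j<k} |z_j² - z_k²|^β ∏_j |z_j|^γ exp(-z_j²/2)`. -/
def groundState {N : ℕ} (β : ℕ) (γ : ℝ) (z : Fin N → ℝ) : ℝ :=
  (∏ p ∈ Finset.univ.filter (fun p : Fin N × Fin N => p.1 < p.2),
      |z p.1 ^ 2 - z p.2 ^ 2| ^ β) *
    ∏ j, (|z j| ^ γ * Real.exp (-(z j) ^ 2 / 2))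

/-- The scalar product `∫_{ℝ^N} f(z) g(z) φ(z)² dz`, `φ` being the ground state. -/
def scalarProd {N : ℕ} (β : ℕ) (γ : ℝ) (f g : Poly N) : ℂ :=
  ∫ z : Fin N → ℝ, eval (fun i => (z i : ℂ)) f * eval (fun i => (z i : ℂ)) g *
    ((groundState β γ z ^ 2 : ℝ) : ℂ)

/-- The two conditions that characterize the multivariable Laguerre polynomial labelled by the
partition `lam`: it is `m_lam(z²)` plus a combination of the `m_μ(z²)` with `μ < lam`, and it is
orthogonal to all these `m_μ(z²)`. -/
structure IsLaguerre {N : ℕ} (β : ℕ) (γ : ℝ) (lam : Fin N → ℕ) (L : Poly N) : Prop where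
  triangular : L - mSq lam ∈
    Submodule.span ℂ {p : Poly N | ∃ μ : Fin N → ℕ, Antitone μ ∧ DomLT μ lam ∧ p = mSq μ}
  orthogonal : ∀ μ : Fin N → ℕ, Antitone μ → DomLT μ lam → scalarProd β γ L (mSq μ) = 0

/-- The partition `lam + δ`, with `δ = (N-1, N-2, …, 0)`. -/
def addDelta {N : ℕ} (lam : Fin N → ℕ) : Fin N → ℕ := fun i => lam i + (N - 1 - (i : ℕ))

/-- `c_lam^{(b)} = ∏_{i<j} (lam_{N-j+1} - lam_{N-i+1} + j - i + (b-1)(j-i-1))`, where the indices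
`i, j` of the formula run from `1` to `N` (so that `lam_{N-j+1}` is `lam (Fin.rev j)`). -/
def cConst {N : ℕ} (b : ℕ) (lam : Fin N → ℕ) : ℂ :=
  ∏ p ∈ Finset.univ.filter (fun p : Fin N × Fin N => p.1 < p.2),
    ((lam (Fin.rev p.2) : ℂ) - (lam (Fin.rev p.1) : ℂ) + (p.2 : ℕ) - (p.1 : ℕ)
      + ((b : ℂ) - 1) * (((p.2 : ℕ) : ℂ) - ((p.1 : ℕ) : ℂ) - 1))

/-- `c̃_lam^{(b)} = ∏_{i<j} (lam_{N-j+1} - lam_{N-i+1} + j - i + (b-1)(j-i+1))`. -/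
def cTilde {N : ℕ} (b : ℕ) (lam : Fin N → ℕ) : ℂ :=
  ∏ p ∈ Finset.univ.filter (fun p : Fin N × Fin N => p.1 < p.2),
    ((lam (Fin.rev p.2) : ℂ) - (lam (Fin.rev p.1) : ℂ) + (p.2 : ℕ) - (p.1 : ℕ)
      + ((b : ℂ) - 1) * (((p.2 : ℕ) : ℂ) - ((p.1 : ℕ) : ℂ) + 1))

end CalogeroB

end

noncomputable section

namespace CalogeroB

variable {N : ℕ}

/-! ### Divided differences and type `A` Dunkl operators -/

/-! On even polynomials `expand 2 f` every $t_j$ is trivial, and $\tilde h_j/2$ becomes an operator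
of type $A$ on $f$, namely `opA`: $x_jT_j-T_jx_jT_j-(\gamma-\tfrac12)T_j+\beta\sum_{k<j}s_{jk}$ with
$T_j$ the type $A$ Dunkl operator (`h_expand`). The whole proof takes place in the variables
$x_j=z_j^2$, where $\mathcal X_L$ is the Vandermonde polynomial $V$. It rests on three properties of
these operators.

Exchange relations. The `opA` commute (`opA_comm`) and, together with the adjacent transpositions,
satisfy the relations of a graded Hecke algebra. A polynomial in them therefore passes through
$s_{a,a+1}$ at the cost of a divided difference (`s_evalOp`). It follows that $\mathcal Y_L$ turns
symmetric polynomials into antisymmetric ones, which are divisible by $V$, and that $\hat{\mathcal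
Y}_L$ turns antisymmetric ones into symmetric ones.

Triangularity. Bound the sum of exponents over every set of $k$ variables by $\nu_1+\dots+\nu_k$.
The `opA` preserve this space, and they multiply the coefficient of the increasing rearrangement of
$\nu$ by explicit scalars $\nu_{N-j+1}+\beta(j-1)$ (`IsExtremal.coeff_opA`). Multiplication by $V$
shifts the bound exactly from $\lambda$ to $\lambda+\delta$ (`vand_mul_mem_addDelta_iff`) and keeps
the leading coefficient (`coeff_vand_mul`). The scalars at $\lambda+\delta$ give the two constants,
the sign of the reversal reordering the factors.

Self-adjointness. The `opA` are symmetric for the scalar product (`form_opA`), and the product for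
$\beta+1$ of $f,g$ is that for $\beta$ of $Vf,Vg$ (`form_succ`). Moving $\mathcal Y_L$ or
$\hat{\mathcal Y}_L$ to the other argument, where triangularity controls it, yields orthogonality to
all lower $m_\mu$. Positivity of the scalar product makes a polynomial with these properties unique
up to its leading coefficient (`IsLaguerreSq.unique`), which proves both relations. -/

theorem s_apply (j k : Fin N) (f : Poly N) : s j k f = rename (Equiv.swap j k) f := rfl

theorem s_X (j k l : Fin N) : s j k (X l : Poly N) = X (Equiv.swap j k l) := by
  simp [s_apply]

theorem s_mul (j k : Fin N) (f g : Poly N) : s j k (f * g) = s j k f * s j k g := by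
  simp [s_apply]

theorem s_s (j k : Fin N) (f : Poly N) : s j k (s j k f) = f := by
  simp [s_apply, rename_rename, ← Equiv.coe_trans]

theorem s_comm (j k : Fin N) : (s j k : Module.End ℂ (Poly N)) = s k j := by
  ext1; simp [s, sAlg, Equiv.swap_comm]

theorem X_sub_X_ne_zero {j k : Fin N} (hjk : j ≠ k) : (X j - X k : Poly N) ≠ 0 :=
  sub_ne_zero.mpr fun e => hjk (X_injective e)

theorem rename_s (w : Equiv.Perm (Fin N)) (j k : Fin N) (f : Poly N) :
    rename w (s j k f) = s (w j) (w k) (rename w f) := by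
  simp only [s_apply, rename_rename, ← Equiv.coe_trans]
  congr 2
  ext x
  simp [Equiv.swap_apply_apply]

theorem eq_diffMinus {j k : Fin N} (hjk : j ≠ k) {f g : Poly N}
    (e : (X j - X k) * g = f - s j k f) : diffMinus j k f = g :=
  mul_left_cancel₀ (X_sub_X_ne_zero hjk) ((mul_diffMinus hjk f).trans e.symm)

theorem diffMinus_X_mul_of_ne {j k l : Fin N} (hjk : j ≠ k) (hj : l ≠ j) (hk : l ≠ k)
    (f : Poly N) : diffMinus j k (X l * f) = X l * diffMinus j k f := by
  apply eq_diffMinus hjk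
  rw [s_mul, s_X, Equiv.swap_apply_of_ne_of_ne hj hk]
  linear_combination X l * mul_diffMinus hjk f

theorem diffMinus_X_left_mul {j k : Fin N} (hjk : j ≠ k) (f : Poly N) :
    diffMinus j k (X j * f) = X j * diffMinus j k f + s j k f := by
  apply eq_diffMinus hjk
  rw [s_mul, s_X, Equiv.swap_apply_left]
  linear_combination X j * mul_diffMinus hjk f

theorem diffMinus_X_right_mul {j k : Fin N} (hjk : j ≠ k) (f : Poly N) :
    diffMinus j k (X k * f) = X k * diffMinus j k f - s j k f := by
  apply eq_diffMinus hjk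
  rw [s_mul, s_X, Equiv.swap_apply_right]
  linear_combination X k * mul_diffMinus hjk f

theorem rename_diffMinus (w : Equiv.Perm (Fin N)) {j k : Fin N} (hjk : j ≠ k) (f : Poly N) :
    rename w (diffMinus j k f) = diffMinus (w j) (w k) (rename w f) := by
  symm
  apply eq_diffMinus (w.injective.ne hjk)
  have := congrArg (rename w) (mul_diffMinus hjk f)
  rwa [map_mul, map_sub, map_sub, rename_s, rename_X, rename_X] at this

theorem diffMinus_swap {j k : Fin N} (hjk : j ≠ k) (f : Poly N) :
    diffMinus k j f = -diffMinus j k f := by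
  apply eq_diffMinus hjk.symm
  rw [s_comm]
  linear_combination mul_diffMinus hjk f

theorem diffMinus_C {j k : Fin N} (hjk : j ≠ k) (a : ℂ) : diffMinus j k (C a : Poly N) = 0 := by
  apply eq_diffMinus hjk
  simp [s_apply]

/-- The Dunkl operator of type `A`. -/
def dunklA (β : ℕ) (j : Fin N) : Module.End ℂ (Poly N) :=
  (pderiv j).toLinearMap + (β : ℂ) • ∑ k ∈ Finset.univ.filter (fun k => k ≠ j), diffMinus j k

theorem dunklA_apply (β : ℕ) (j : Fin N) (f : Poly N) : dunklA β j f =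
    pderiv j f + (β : ℂ) • ∑ k ∈ Finset.univ.filter (fun k => k ≠ j), diffMinus j k f := by
  simp [dunklA, LinearMap.sum_apply]

theorem rename_dunklA (β : ℕ) (w : Equiv.Perm (Fin N)) (j : Fin N) (f : Poly N) :
    rename w (dunklA β j f) = dunklA β (w j) (rename w f) := by
  rw [dunklA_apply, dunklA_apply, map_add, pderiv_rename w.injective, map_smul, map_sum]
  congr 2
  refine Finset.sum_equiv w (fun k => by simp) fun k hk => ?_
  exact rename_diffMinus w (by simpa [eq_comm] using hk) f

theorem s_dunklA (β : ℕ) (i k j : Fin N) (f : Poly N) :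
    s i k (dunklA β j f) = dunklA β (Equiv.swap i k j) (s i k f) := rename_dunklA β _ j f

/-- Among the divided differences in $T_i$, only the one along $(i,k)$ fails to commute with $X_k$.
-/
theorem dunklA_X_mul_of_ne (β : ℕ) {i k : Fin N} (hik : i ≠ k) (f : Poly N) :
    dunklA β i (X k * f) = X k * dunklA β i f - (β : ℂ) • s i k f := by
  have e : ∑ l ∈ Finset.univ.filter (fun l => l ≠ i), diffMinus i l (X k * f) =
      X k * ∑ l ∈ Finset.univ.filter (fun l => l ≠ i), diffMinus i l f - s i k f := by
    have hk : k ∈ Finset.univ.filter (fun l => l ≠ i) := by simp [hik.symm]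
    rw [← Finset.add_sum_erase _ _ hk, ← Finset.add_sum_erase _ _ hk, mul_add,
      diffMinus_X_right_mul hik, Finset.mul_sum]
    rw [Finset.sum_congr rfl fun l hl => diffMinus_X_mul_of_ne (l := k) (j := i) (k := l)
      (by simp at hl; tauto) hik.symm (by simp at hl; tauto) f]
    ring
  rw [dunklA_apply, dunklA_apply, e, Derivation.leibniz, pderiv_X_of_ne hik.symm]
  simp only [smul_eq_mul, MvPolynomial.smul_eq_C_mul]
  ring

theorem dunklA_X_mul_self (β : ℕ) (i : Fin N) (f : Poly N) :
    dunklA β i (X i * f) = X i * dunklA β i f + f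
      + (β : ℂ) • ∑ k ∈ Finset.univ.filter (fun k => k ≠ i), s i k f := by
  have e : ∑ l ∈ Finset.univ.filter (fun l => l ≠ i), diffMinus i l (X i * f) =
      X i * ∑ l ∈ Finset.univ.filter (fun l => l ≠ i), diffMinus i l f
      + ∑ l ∈ Finset.univ.filter (fun l => l ≠ i), s i l f := by
    rw [Finset.mul_sum, ← Finset.sum_add_distrib]
    exact Finset.sum_congr rfl fun l hl => diffMinus_X_left_mul (by simp at hl; tauto) f
  rw [dunklA_apply, dunklA_apply, e, Derivation.leibniz, pderiv_X_self]
  simp only [smul_eq_mul, MvPolynomial.smul_eq_C_mul]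
  ring

theorem dunklA_C (β : ℕ) (i : Fin N) (a : ℂ) : dunklA β i (C a : Poly N) = 0 := by
  rw [dunklA_apply, Finset.sum_eq_zero fun k hk => diffMinus_C (by simp at hk; tauto) a]
  simp

theorem dunklA_comm_X_mul_self {β : ℕ} {i j : Fin N} (hij : i ≠ j) {f : Poly N}
    (ih : dunklA β i (dunklA β j f) = dunklA β j (dunklA β i f)) :
    dunklA β i (dunklA β j (X i * f)) = dunklA β j (dunklA β i (X i * f)) := by
  have hj : j ∈ Finset.univ.filter (fun l => l ≠ i) := by simp [hij.symm]
  -- Here $s_{ik}$ commutes with $T_j$ except for $k=j$, where $s_{ij}T_j=T_is_{ij}$.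
  have e : ∑ k ∈ Finset.univ.filter (fun k => k ≠ i), s i k (dunklA β j f) =
      ∑ k ∈ Finset.univ.filter (fun k => k ≠ i), dunklA β j (s i k f)
      + dunklA β i (s i j f) - dunklA β j (s i j f) := by
    rw [← Finset.add_sum_erase _ _ hj, ← Finset.add_sum_erase _ _ hj, s_dunklA,
      Equiv.swap_apply_right]
    rw [Finset.sum_congr rfl fun k hk => show s i k (dunklA β j f) = dunklA β j (s i k f) by
      rw [s_dunklA, Equiv.swap_apply_of_ne_of_ne hij.symm (by simp at hk; tauto)]]
    ring
  rw [dunklA_X_mul_of_ne β hij.symm, dunklA_X_mul_self, map_sub, dunklA_X_mul_self, map_add,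
    map_add, dunklA_X_mul_of_ne β hij.symm, map_smul, map_smul, map_sum, e, ih, s_comm j i,
    s_dunklA, Equiv.swap_apply_left]
  simp only [MvPolynomial.smul_eq_C_mul]
  ring

/-- Induction on the degree: constants are killed by every $T_i$, and moving $X_k$ out of $T_iT_j$
and of $T_jT_i$ leaves the same reflection terms. -/
theorem dunklA_comm (β : ℕ) (i j : Fin N) (f : Poly N) :
    dunklA β i (dunklA β j f) = dunklA β j (dunklA β i f) := by
  rcases eq_or_ne i j with rfl | hij
  · rfl
  induction f using MvPolynomial.induction_on with
  | C a => simp [dunklA_C]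
  | add p q hp hq => simp [hp, hq]
  | mul_X p k ih =>
    rw [mul_comm]
    rcases eq_or_ne k i with rfl | hki
    · exact dunklA_comm_X_mul_self hij ih
    rcases eq_or_ne k j with rfl | hkj
    · exact (dunklA_comm_X_mul_self hij.symm ih.symm).symm
    rw [dunklA_X_mul_of_ne β hkj.symm, dunklA_X_mul_of_ne β hki.symm, map_sub, map_sub,
      dunklA_X_mul_of_ne β hkj.symm, dunklA_X_mul_of_ne β hki.symm, map_smul, map_smul, ih,
      s_dunklA, s_dunklA, Equiv.swap_apply_of_ne_of_ne hij.symm hkj.symm,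
      Equiv.swap_apply_of_ne_of_ne hij hki.symm]
    abel

/-! ### The commuting operators in the squared variables -/

/-- `w_j = x_j T_j`. -/
def eulerA (β : ℕ) (j : Fin N) : Module.End ℂ (Poly N) := mulOp (X j) * dunklA β j

theorem eulerA_apply (β : ℕ) (j : Fin N) (f : Poly N) :
    eulerA β j f = X j * dunklA β j f := rfl

/-- `b_j† b_j / 2` in the squared variables. -/
def quadA (β : ℕ) (γ : ℝ) (j : Fin N) : Module.End ℂ (Poly N) :=
  eulerA β j - dunklA β j * eulerA β j - ((γ : ℂ) - 1 / 2) • dunklA β j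

theorem quadA_apply (β : ℕ) (γ : ℝ) (j : Fin N) (f : Poly N) : quadA β γ j f =
    eulerA β j f - dunklA β j (eulerA β j f) - ((γ : ℂ) - 1 / 2) • dunklA β j f := rfl

theorem rename_eulerA (β : ℕ) (w : Equiv.Perm (Fin N)) (j : Fin N) (f : Poly N) :
    rename w (eulerA β j f) = eulerA β (w j) (rename w f) := by
  rw [eulerA_apply, eulerA_apply, map_mul, rename_X, rename_dunklA]

theorem rename_quadA (β : ℕ) (γ : ℝ) (w : Equiv.Perm (Fin N)) (j : Fin N) (f : Poly N) :
    rename w (quadA β γ j f) = quadA β γ (w j) (rename w f) := by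
  rw [quadA_apply, quadA_apply, map_sub, map_sub, map_smul, rename_dunklA, rename_eulerA,
    rename_dunklA]

theorem s_eulerA (β : ℕ) (i k j : Fin N) (f : Poly N) :
    s i k (eulerA β j f) = eulerA β (Equiv.swap i k j) (s i k f) := rename_eulerA β _ j f

theorem s_quadA (β : ℕ) (γ : ℝ) (i k j : Fin N) (f : Poly N) :
    s i k (quadA β γ j f) = quadA β γ (Equiv.swap i k j) (s i k f) := rename_quadA β γ _ j f

theorem eulerA_dunklA (β : ℕ) {i j : Fin N} (hij : i ≠ j) (f : Poly N) :
    eulerA β i (dunklA β j f) = dunklA β j (eulerA β i f) + (β : ℂ) • dunklA β j (s i j f) := by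
  rw [eulerA_apply, eulerA_apply, dunklA_X_mul_of_ne β hij.symm, s_comm j i, s_dunklA,
    Equiv.swap_apply_left, dunklA_comm β j i]
  abel

theorem eulerA_eulerA (β : ℕ) {i j : Fin N} (hij : i ≠ j) (f : Poly N) :
    eulerA β i (eulerA β j f) - eulerA β j (eulerA β i f) =
      -(β : ℂ) • (eulerA β i (s i j f) - eulerA β j (s i j f)) := by
  simp only [eulerA_apply]
  rw [dunklA_X_mul_of_ne β hij, dunklA_X_mul_of_ne β hij.symm, s_comm j i, s_dunklA, s_dunklA,
    Equiv.swap_apply_left, Equiv.swap_apply_right, dunklA_comm β j i]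
  simp only [MvPolynomial.smul_eq_C_mul, map_neg]
  ring

/-- The commutator has the same shape as that of the Euler operators $w_i=x_iT_i$. Since the $T_i$
commute, it is assembled from `eulerA_eulerA` and its images under $T_iT_j$, $T_i$ and $T_j$. -/
theorem quadA_quadA (β : ℕ) (γ : ℝ) {i j : Fin N} (hij : i ≠ j) (f : Poly N) :
    quadA β γ i (quadA β γ j f) - quadA β γ j (quadA β γ i f) =
      -(β : ℂ) • (quadA β γ i (s i j f) - quadA β γ j (s i j f)) := by
  have e1 := eulerA_eulerA β hij f
  have e2 : dunklA β i (dunklA β j (eulerA β i (eulerA β j f)))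
      - dunklA β i (dunklA β j (eulerA β j (eulerA β i f))) =
      -(β : ℂ) • (dunklA β i (dunklA β j (eulerA β i (s i j f)))
        - dunklA β i (dunklA β j (eulerA β j (s i j f)))) := by
    rw [← map_sub, ← map_sub, e1]; simp
  have e3 := congrArg (dunklA β i) e1
  have e4 := congrArg (dunklA β j) e1
  simp only [quadA_apply, map_sub, map_smul, eulerA_dunklA β hij, eulerA_dunklA β hij.symm,
    map_add, s_comm j i, s_eulerA, Equiv.swap_apply_left, Equiv.swap_apply_right,
    dunklA_comm β j i] at e1 e2 e3 e4 ⊢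
  simp only [MvPolynomial.smul_eq_C_mul, map_neg, map_sub] at e1 e2 e3 e4 ⊢
  linear_combination e1 + e2 - e3 - e4

/-- `h_j / 2` in the squared variables. -/
def opA (β : ℕ) (γ : ℝ) (j : Fin N) : Module.End ℂ (Poly N) :=
  quadA β γ j + (β : ℂ) • ∑ k ∈ Finset.univ.filter (fun k => k < j), s j k

theorem opA_apply (β : ℕ) (γ : ℝ) (j : Fin N) (f : Poly N) : opA β γ j f =
    quadA β γ j f + (β : ℂ) • ∑ k ∈ Finset.univ.filter (fun k => k < j), s j k f := by
  simp [opA, LinearMap.sum_apply]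

/-- The Jucys–Murphy type sum $\sum_{k<j}s_{jk}$ is there to cancel the commutator in `quadA_quadA`:
its term $k=i$ is the only one not commuting with `quadA β γ i`. -/
theorem opA_comm_of_lt (β : ℕ) (γ : ℝ) {i j : Fin N} (hij : i < j) (f : Poly N) :
    opA β γ i (opA β γ j f) = opA β γ j (opA β γ i f) := by
  have hi : i ∈ Finset.univ.filter (fun k => k < j) := by simpa using hij
  have e1 : ∑ k ∈ Finset.univ.filter (fun k => k < j), s j k (quadA β γ i f) =
      quadA β γ i (∑ k ∈ Finset.univ.filter (fun k => k < j), s j k f)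
      - quadA β γ i (s i j f) + quadA β γ j (s i j f) := by
    rw [map_sum, ← Finset.add_sum_erase _ _ hi, ← Finset.add_sum_erase _ _ hi, s_quadA,
      Equiv.swap_apply_right, s_comm j i]
    rw [Finset.sum_congr rfl fun k hk => show s j k (quadA β γ i f) = quadA β γ i (s j k f) by
      rw [s_quadA, Equiv.swap_apply_of_ne_of_ne hij.ne (by simp at hk; tauto)]]
    ring
  have e2 : ∑ l ∈ Finset.univ.filter (fun l => l < i), s i l (quadA β γ j f) =
      quadA β γ j (∑ l ∈ Finset.univ.filter (fun l => l < i), s i l f) := by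
    rw [map_sum]
    refine Finset.sum_congr rfl fun l hl => ?_
    rw [s_quadA, Equiv.swap_apply_of_ne_of_ne hij.ne' (by
      simp at hl; exact (hl.trans hij).ne')]
  -- For $l<i<j$, conjugation by $s_{il}$ permutes the transpositions $s_{jk}$, $k<j$, so the two
  -- sums commute.
  have e3 : ∑ l ∈ Finset.univ.filter (fun l => l < i),
        s i l (∑ k ∈ Finset.univ.filter (fun k => k < j), s j k f) =
      ∑ k ∈ Finset.univ.filter (fun k => k < j),
        s j k (∑ l ∈ Finset.univ.filter (fun l => l < i), s i l f) := by
    simp only [map_sum]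
    rw [Finset.sum_comm (s := Finset.univ.filter (fun k => k < j))]
    refine Finset.sum_congr rfl fun l hl => ?_
    have hl : l < i := by simpa using hl
    refine Finset.sum_equiv (Equiv.swap i l) (fun k => ?_) fun k hk => ?_
    · have hl' := hl.trans hij
      simp only [Finset.mem_filter, Finset.mem_univ, true_and]
      by_cases h1 : k = i
      · subst h1; simp [hij, hl']
      by_cases h2 : k = l
      · subst h2; simp [hij, hl']
      rw [Equiv.swap_apply_of_ne_of_ne h1 h2]
    · rw [s_apply i l, rename_s, Equiv.swap_apply_of_ne_of_ne hij.ne' (hl.trans hij).ne',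
        s_apply i l]
  have e0 := quadA_quadA β γ hij.ne f
  simp only [opA_apply, map_add, map_smul] at *
  rw [e1, e2, e3]
  simp only [MvPolynomial.smul_eq_C_mul, map_neg] at *
  linear_combination e0

theorem opA_comm (β : ℕ) (γ : ℝ) (i j : Fin N) (f : Poly N) :
    opA β γ i (opA β γ j f) = opA β γ j (opA β γ i f) := by
  rcases lt_trichotomy i j with hij | rfl | hij
  · exact opA_comm_of_lt β γ hij f
  · rfl
  · exact (opA_comm_of_lt β γ hij f).symm

/-! ### Graded Hecke relations with adjacent transpositions -/

theorem s_opA_of_ne (β : ℕ) (γ : ℝ) {a b j : Fin N} (hab : (b : ℕ) = a + 1) (ha : j ≠ a)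
    (hb : j ≠ b) (f : Poly N) : s a b (opA β γ j f) = opA β γ j (s a b f) := by
  rw [opA_apply, opA_apply, map_add, map_smul, map_sum, s_quadA,
    Equiv.swap_apply_of_ne_of_ne ha hb]
  congr 2
  refine Finset.sum_equiv (Equiv.swap a b) (fun k => ?_) fun k hk => ?_
  · simp only [Finset.mem_filter, Finset.mem_univ, true_and]
    have ha' : (j : ℕ) ≠ a := fun e => ha (Fin.ext e)
    have hb' : (j : ℕ) ≠ b := fun e => hb (Fin.ext e)
    by_cases h1 : k = a
    · subst h1; simp only [Equiv.swap_apply_left, Fin.lt_def]; omega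
    by_cases h2 : k = b
    · subst h2; simp only [Equiv.swap_apply_right, Fin.lt_def]; omega
    rw [Equiv.swap_apply_of_ne_of_ne h1 h2]
  · rw [s_apply a b, rename_s, Equiv.swap_apply_of_ne_of_ne ha hb, s_apply a b]

/-- Conjugation by $s_{ab}$ carries the sum over $k<a$ to the sum over $k<b$ without its term $k=a$;
that missing reflection, composed with $s_{ab}$, is the scalar correction. This needs $b=a+1$. -/
theorem s_opA_left (β : ℕ) (γ : ℝ) {a b : Fin N} (hab : (b : ℕ) = a + 1) (f : Poly N) :
    s a b (opA β γ a f) = opA β γ b (s a b f) - (β : ℂ) • f := by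
  have ha : a ∈ Finset.univ.filter (fun k => k < b) := by
    simp only [Finset.mem_filter, Finset.mem_univ, true_and, Fin.lt_def]
    omega
  have e : (Finset.univ.filter (fun k => k < b)).erase a = Finset.univ.filter (fun k => k < a) := by
    ext k
    simp only [Finset.mem_erase, Finset.mem_filter, Finset.mem_univ, true_and, Fin.lt_def, ne_eq,
      Fin.ext_iff]
    omega
  rw [opA_apply, opA_apply, map_add, map_smul, map_sum, s_quadA, Equiv.swap_apply_left,
    ← Finset.add_sum_erase _ _ ha, e, s_comm b a, s_s]
  rw [Finset.sum_congr rfl fun k hk => show s a b (s a k f) = s b k (s a b f) by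
    have hk : k < a := by simpa using hk
    rw [s_apply a b, rename_s, Equiv.swap_apply_left, Equiv.swap_apply_of_ne_of_ne hk.ne (by
      intro e; subst e; rw [Fin.lt_def] at hk; omega), s_apply a b]]
  rw [smul_add]
  abel

theorem s_opA_right (β : ℕ) (γ : ℝ) {a b : Fin N} (hab : (b : ℕ) = a + 1) (f : Poly N) :
    s a b (opA β γ b f) = opA β γ a (s a b f) + (β : ℂ) • f := by
  have := s_opA_left β γ hab (s a b f)
  have := congrArg (s a b) this
  rw [s_s, s_s, map_sub, map_smul, s_s] at this
  rw [this, sub_add_cancel]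

/-! ### Polynomials in the commuting operators -/

theorem opA_mul_comm (β : ℕ) (γ : ℝ) : ∀ A ∈ Set.range (opA (N := N) β γ),
    ∀ B ∈ Set.range (opA (N := N) β γ), A * B = B * A := by
  rintro _ ⟨i, rfl⟩ _ ⟨j, rfl⟩
  exact LinearMap.ext fun f => opA_comm β γ i j f

/-- Polynomials in the commuting operators `opA`. -/
def evalOp (β : ℕ) (γ : ℝ) : Poly N →ₐ[ℂ] Module.End ℂ (Poly N) :=
  -- `aeval` needs a commutative target, so the values are first taken in the commutative subalgebra
  -- generated by the `opA`.
  letI : CommRing (Algebra.adjoin ℂ (Set.range (opA (N := N) β γ))) :=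
    { (Algebra.adjoin ℂ (Set.range (opA (N := N) β γ))).toRing with
      mul_comm := (Algebra.isMulCommutative_adjoin ℂ (opA_mul_comm β γ)).is_comm.comm }
  (Algebra.adjoin ℂ (Set.range (opA (N := N) β γ))).val.comp
    (aeval fun j =>
      (⟨opA β γ j, Algebra.subset_adjoin ⟨j, rfl⟩⟩ : Algebra.adjoin ℂ (Set.range (opA (N := N) β γ))))

theorem evalOp_X (β : ℕ) (γ : ℝ) (j : Fin N) : evalOp β γ (X j) = opA β γ j := by
  simp [evalOp]

theorem evalOp_X_mul (β : ℕ) (γ : ℝ) (j : Fin N) (p f : Poly N) :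
    evalOp β γ (X j * p) f = opA β γ j (evalOp β γ p f) := by
  rw [map_mul, evalOp_X]; rfl

theorem evalOp_C (β : ℕ) (γ : ℝ) (a : ℂ) (f : Poly N) : evalOp β γ (C a) f = a • f := by
  have : (C a : Poly N) = algebraMap ℂ _ a := rfl
  rw [this, AlgHom.commutes]; rfl

theorem evalOp_X_mul' (β : ℕ) (γ : ℝ) (j : Fin N) (p f : Poly N) :
    evalOp β γ (p * X j) f = opA β γ j (evalOp β γ p f) := by
  rw [mul_comm, evalOp_X_mul]

/-- The relation of Bernstein–Lusztig type. It holds for the generators by the three exchange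
relations and extends to products because `diffMinus` obeys the matching twisted Leibniz rule. -/
theorem s_evalOp (β : ℕ) (γ : ℝ) {a b : Fin N} (hab : (b : ℕ) = a + 1) (p f : Poly N) :
    s a b (evalOp β γ p f) =
      evalOp β γ (s a b p) (s a b f) - (β : ℂ) • evalOp β γ (diffMinus a b p) f := by
  have hne : a ≠ b := by rintro rfl; omega
  induction p using MvPolynomial.induction_on with
  | C c => simp [diffMinus_C hne, s_apply]
  | add p q hp hq =>
    simp only [map_add, LinearMap.add_apply, hp, hq, smul_add]
    abel
  | mul_X p k ih =>
    rw [mul_comm, evalOp_X_mul, s_mul, s_X, evalOp_X_mul]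
    by_cases ha : k = a
    · subst ha
      rw [s_opA_left β γ hab, ih, Equiv.swap_apply_left, diffMinus_X_left_mul hne,
        show X k * diffMinus k b p + s k b p = X b * diffMinus k b p + p by
          linear_combination mul_diffMinus hne p,
        map_add, map_sub, map_smul, LinearMap.add_apply, evalOp_X_mul, smul_add]
      abel
    by_cases hb : k = b
    · subst hb
      rw [s_opA_right β γ hab, ih, Equiv.swap_apply_right, diffMinus_X_right_mul hne,
        show X k * diffMinus a k p - s a k p = X a * diffMinus a k p - p by
          linear_combination -mul_diffMinus hne p,
        map_sub, map_sub, map_smul, LinearMap.sub_apply, evalOp_X_mul, smul_sub]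
      abel
    rw [s_opA_of_ne β γ hab ha hb, ih, Equiv.swap_apply_of_ne_of_ne ha hb,
      diffMinus_X_mul_of_ne hne ha hb, evalOp_X_mul, map_sub, map_smul]

/-! ### Symmetric and antisymmetric polynomials -/

/-- Antisymmetric polynomials. -/
def IsAntisymmetric (f : Poly N) : Prop :=
  ∀ w : Equiv.Perm (Fin N), rename w f = ((Equiv.Perm.sign w : ℤ) : ℂ) • f

theorem perm_induction {p : Equiv.Perm (Fin N) → Prop} (one : p 1)
    (mul : ∀ v w, p v → p w → p (v * w))
    (adj : ∀ a b : Fin N, (b : ℕ) = a + 1 → p (Equiv.swap a b)) (w : Equiv.Perm (Fin N)) :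
    p w := by
  rcases N with _ | n
  · rwa [Subsingleton.elim w 1]
  have hw : w ∈ Submonoid.closure
      (Set.range fun i : Fin n => Equiv.swap i.castSucc i.succ) := by
    rw [Equiv.Perm.mclosure_swap_castSucc_succ]; trivial
  induction hw using Submonoid.closure_induction with
  | mem x hx =>
    obtain ⟨i, rfl⟩ := hx
    exact adj _ _ (by simp)
  | one => exact one
  | mul x y _ _ hx hy => exact mul x y hx hy

theorem rename_mul_perm (v w : Equiv.Perm (Fin N)) (f : Poly N) :
    rename (v * w : Equiv.Perm (Fin N)) f = rename v (rename w f) := by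
  rw [rename_rename]; rfl

theorem isSymmetric_of_adjacent {f : Poly N}
    (hf : ∀ a b : Fin N, (b : ℕ) = a + 1 → s a b f = f) : f.IsSymmetric := fun w => by
  induction w using perm_induction with
  | one => exact rename_id_apply f
  | mul v w hv hw => rw [rename_mul_perm, hw, hv]
  | adj a b hab => exact hf a b hab

theorem isAntisymmetric_of_adjacent {f : Poly N}
    (hf : ∀ a b : Fin N, (b : ℕ) = a + 1 → s a b f = -f) : IsAntisymmetric f := fun w => by
  induction w using perm_induction with
  | one => simp
  | mul v w hv hw => rw [rename_mul_perm, hw, map_smul, hv, smul_smul]; simp [mul_comm]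
  | adj a b hab =>
    have hne : a ≠ b := by rintro rfl; omega
    rw [← s_apply, hf a b hab, Equiv.Perm.sign_swap hne]; simp

theorem IsAntisymmetric.s_eq {f : Poly N} (hf : IsAntisymmetric f) {a b : Fin N} (hne : a ≠ b) :
    s a b f = -f := by
  rw [s_apply, hf, Equiv.Perm.sign_swap hne]; simp

/-- `∏_{i<j} (c + X_i - X_j)`. -/
def shiftPoly (N : ℕ) (c : ℂ) : Poly N :=
  ∏ p ∈ Finset.univ.filter (fun p : Fin N × Fin N => p.1 < p.2), (C c + X p.1 - X p.2)

/-- `shiftPoly` without the factor of `(a, b)`. -/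
def shiftPolyErase (c : ℂ) (a b : Fin N) : Poly N :=
  ∏ p ∈ (Finset.univ.filter (fun p : Fin N × Fin N => p.1 < p.2)).erase (a, b),
    (C c + X p.1 - X p.2)

theorem shiftPoly_eq (c : ℂ) {a b : Fin N} (hab : a < b) :
    shiftPoly N c = (C c + X a - X b) * shiftPolyErase c a b := by
  rw [shiftPoly, shiftPolyErase, ← Finset.mul_prod_erase _ _
    (show (a, b) ∈ Finset.univ.filter (fun p : Fin N × Fin N => p.1 < p.2) by simpa using hab)]

theorem val_swap_apply (a b i : Fin N) : (Equiv.swap a b i : ℕ) =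
    if (i : ℕ) = a then (b : ℕ) else if (i : ℕ) = b then (a : ℕ) else i := by
  rw [Equiv.swap_apply_def]
  simp only [Fin.ext_iff]
  split_ifs <;> rfl

/-- A simple reflection permutes the positive roots other than its own. -/
theorem s_shiftPolyErase (c : ℂ) {a b : Fin N} (hab : (b : ℕ) = a + 1) :
    s a b (shiftPolyErase c a b) = shiftPolyErase c a b := by
  rw [s_apply, shiftPolyErase, map_prod]
  refine Finset.prod_equiv ((Equiv.swap a b).prodCongr (Equiv.swap a b)) (fun p => ?_)
    fun p hp => by simp
  obtain ⟨i, j⟩ := p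
  simp only [Finset.mem_erase, ne_eq, Prod.mk.injEq, Finset.mem_filter, Finset.mem_univ, true_and,
    Equiv.prodCongr_apply, Prod.map_apply, Fin.ext_iff, Fin.lt_def, val_swap_apply]
  split_ifs <;> omega

/-- Only the factor $c+X_a-X_b$ is moved by $s_{ab}$, and its divided difference is $2$. The choices
$c=\beta$ on symmetric $f$ and $c=-\beta$ on antisymmetric $f$ are those for which the extra term
$-2\beta$ turns the right side into $\mp$ the original. -/
theorem s_evalOp_shiftPoly (β : ℕ) (γ : ℝ) (c : ℂ) {a b : Fin N} (hab : (b : ℕ) = a + 1)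
    (f : Poly N) : s a b (evalOp β γ (shiftPoly N c) f) =
      c • evalOp β γ (shiftPolyErase c a b) (s a b f)
      + evalOp β γ ((X b - X a) * shiftPolyErase c a b) (s a b f)
      - (2 * β : ℂ) • evalOp β γ (shiftPolyErase c a b) f := by
  have hne : a ≠ b := by rintro rfl; omega
  have hlt : a < b := Fin.lt_def.mpr (by omega)
  have hd : diffMinus a b (shiftPoly N c) = 2 * shiftPolyErase c a b := by
    apply eq_diffMinus hne
    rw [shiftPoly_eq c hlt, s_mul, s_shiftPolyErase c hab]
    simp only [map_add, map_sub, s_X, Equiv.swap_apply_left, Equiv.swap_apply_right]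
    simp only [s_apply, rename_C]
    ring
  rw [s_evalOp β γ hab, hd, shiftPoly_eq c hlt, s_mul,
    s_shiftPolyErase c hab]
  have e : s a b (C c + X a - X b : Poly N) = C c + (X b - X a) := by
    simp only [map_add, map_sub, s_X, Equiv.swap_apply_left, Equiv.swap_apply_right]
    simp only [s_apply, rename_C]
    ring
  rw [e, add_mul, map_add, LinearMap.add_apply, ← smul_eq_C_mul, map_smul, LinearMap.smul_apply,
    two_mul, map_add, LinearMap.add_apply, two_mul, add_smul, smul_add]

theorem evalOp_shiftPoly (β : ℕ) (γ : ℝ) (c : ℂ) {a b : Fin N} (hab : (b : ℕ) = a + 1)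
    (f : Poly N) : evalOp β γ (shiftPoly N c) f =
      c • evalOp β γ (shiftPolyErase c a b) f
      - evalOp β γ ((X b - X a) * shiftPolyErase c a b) f := by
  rw [shiftPoly_eq c (Fin.lt_def.mpr (by omega) : a < b),
    show (C c + X a - X b : Poly N) = C c - (X b - X a) by ring, sub_mul, map_sub,
    LinearMap.sub_apply, ← smul_eq_C_mul, map_smul, LinearMap.smul_apply]

theorem isAntisymmetric_evalOp (β : ℕ) (γ : ℝ) {f : Poly N} (hf : f.IsSymmetric) :
    IsAntisymmetric (evalOp β γ (shiftPoly N β) f) := by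
  refine isAntisymmetric_of_adjacent fun a b hab => ?_
  have hs : s a b f = f := hf _
  rw [s_evalOp_shiftPoly β γ _ hab, hs, evalOp_shiftPoly β γ _ hab, two_mul, add_smul]
  abel

theorem isSymmetric_evalOp (β : ℕ) (γ : ℝ) {f : Poly N} (hf : IsAntisymmetric f) :
    (evalOp β γ (shiftPoly N (-β)) f).IsSymmetric := by
  refine isSymmetric_of_adjacent fun a b hab => ?_
  have hne : a ≠ b := by rintro rfl; omega
  rw [s_evalOp_shiftPoly β γ _ hab, hf.s_eq hne, evalOp_shiftPoly β γ _ hab, two_mul, add_smul,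
    map_neg, map_neg]
  simp only [neg_smul, smul_neg]
  abel

/-! ### Passing to squared variables -/

theorem rename_expand_two (w : Equiv.Perm (Fin N)) (f : Poly N) :
    rename w (expand 2 f) = expand 2 (rename w f) := by
  rw [rename_expand]

theorem s_expand (j k : Fin N) (f : Poly N) : s j k (expand 2 f) = expand 2 (s j k f) :=
  rename_expand_two _ f

theorem t_expand (j : Fin N) (f : Poly N) : t j (expand 2 f) = expand 2 f := by
  have : (tAlg j).comp (expand 2) = (expand 2 : Poly N →ₐ[ℂ] Poly N) := by
    refine algHom_ext fun i => ?_
    rcases eq_or_ne i j with rfl | hij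
    · simp [tAlg]
    · simp [tAlg, hij]
  exact DFunLike.congr_fun this f

theorem t_mul (j : Fin N) (f g : Poly N) : t j (f * g) = t j f * t j g :=
  map_mul (tAlg j) f g

theorem t_X_self (j : Fin N) : t j (X j : Poly N) = -X j := by simp [t, tAlg]

theorem t_X_of_ne {j k : Fin N} (hjk : k ≠ j) : t j (X k : Poly N) = X k := by
  simp [t, tAlg, hjk]

theorem pderiv_expand_two (j : Fin N) (f : Poly N) :
    pderiv j (expand 2 f) = 2 * X j * expand 2 (pderiv j f) := by
  induction f using MvPolynomial.induction_on with
  | C a => simp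
  | add p q hp hq => rw [map_add, map_add, hp, hq, map_add, map_add, mul_add]
  | mul_X p k ih =>
    rw [map_mul, Derivation.leibniz, ih, Derivation.leibniz, expand_X]
    rcases eq_or_ne k j with rfl | hkj
    · simp only [pderiv_X_self, Derivation.leibniz_pow, map_add, smul_eq_mul, map_mul, expand_X]
      simp
      ring
    · simp only [pderiv_X_of_ne hkj, Derivation.leibniz_pow, map_add, smul_eq_mul, map_mul,
        expand_X]
      simp
      ring

theorem X_add_X_ne_zero {j k : Fin N} (hjk : j ≠ k) : (X j + X k : Poly N) ≠ 0 := by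
  intro e
  have h1 := congrArg (eval (Pi.single j (1 : ℂ))) e
  simp [hjk.symm] at h1

theorem expand_mul_diffMinus {j k : Fin N} (hjk : j ≠ k) (f : Poly N) :
    (X j ^ 2 - X k ^ 2) * expand 2 (diffMinus j k f) = expand 2 f - expand 2 (s j k f) := by
  have := congrArg (expand 2) (mul_diffMinus hjk f)
  simpa using this

/-- On even polynomials both numerators equal $f-s_{jk}f$, and
$\frac1{z_j-z_k}+\frac1{z_j+z_k}=\frac{2z_j}{z_j^2-z_k^2}$. -/
theorem diffMinus_add_diffPlus_expand {j k : Fin N} (hjk : j ≠ k) (f : Poly N) :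
    diffMinus j k (expand 2 f) + diffPlus j k (expand 2 f) =
      2 * X j * expand 2 (diffMinus j k f) := by
  apply mul_left_cancel₀ (mul_ne_zero (X_sub_X_ne_zero hjk) (X_add_X_ne_zero hjk))
  have e1 := mul_diffMinus hjk (expand 2 f)
  have e2 := mul_diffPlus hjk (expand 2 f)
  rw [s_expand, t_expand, t_expand] at e2
  rw [s_expand] at e1
  linear_combination (X j + X k) * e1 + (X j - X k) * e2 - 2 * X j * expand_mul_diffMinus hjk f

theorem diffMinus_add_diffPlus_X_mul_expand {j k : Fin N} (hjk : j ≠ k) (f : Poly N) :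
    diffMinus j k (X j * expand 2 f) + diffPlus j k (X j * expand 2 f) =
      2 * expand 2 (diffMinus j k (X j * f)) := by
  apply mul_left_cancel₀ (mul_ne_zero (X_sub_X_ne_zero hjk) (X_add_X_ne_zero hjk))
  have e1 := mul_diffMinus hjk (X j * expand 2 f)
  have e2 := mul_diffPlus hjk (X j * expand 2 f)
  rw [s_mul, s_X, Equiv.swap_apply_left, s_expand] at e1 e2
  rw [t_mul, t_mul, t_X_self, map_neg, t_X_of_ne hjk.symm, t_expand, t_expand] at e2
  have e3 := expand_mul_diffMinus hjk (X j * f)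
  rw [s_mul, s_X, Equiv.swap_apply_left, map_mul (expand 2) (X j), map_mul (expand 2) (X k),
    expand_X, expand_X] at e3
  linear_combination (X j + X k) * e1 + (X j - X k) * e2 - 2 * e3

theorem diffSign_expand (j : Fin N) (f : Poly N) : diffSign j (expand 2 f) = 0 := by
  have := mul_diffSign j (expand 2 f)
  rw [t_expand, sub_self] at this
  exact (mul_eq_zero.mp this).resolve_left (X_ne_zero j)

theorem diffSign_X_mul_expand (j : Fin N) (f : Poly N) :
    diffSign j (X j * expand 2 f) = 2 * expand 2 f := by
  apply mul_left_cancel₀ (X_ne_zero (R := ℂ) j)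
  rw [mul_diffSign, t_mul, t_X_self, t_expand]
  ring

theorem dunkl_apply (β : ℕ) (γ : ℝ) (j : Fin N) (f : Poly N) : dunkl β γ j f = pderiv j f
    + (β : ℂ) • ∑ k ∈ Finset.univ.filter (fun k => k ≠ j), (diffMinus j k f + diffPlus j k f)
    + (γ : ℂ) • diffSign j f := by
  simp [dunkl, LinearMap.sum_apply]

theorem dunkl_expand (β : ℕ) (γ : ℝ) (j : Fin N) (f : Poly N) :
    dunkl β γ j (expand 2 f) = 2 * X j * expand 2 (dunklA β j f) := by
  rw [dunkl_apply, diffSign_expand, dunklA_apply, Finset.sum_congr rfl fun k hk =>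
    diffMinus_add_diffPlus_expand (show j ≠ k by simp at hk; tauto) f, ← Finset.mul_sum,
    pderiv_expand_two, map_add, map_smul, map_sum]
  simp only [smul_eq_C_mul]
  ring

theorem dunkl_X_mul_expand (β : ℕ) (γ : ℝ) (j : Fin N) (f : Poly N) :
    dunkl β γ j (X j * expand 2 f) =
      expand 2 ((2 : ℂ) • dunklA β j (X j * f) + (2 * γ - 1 : ℂ) • f) := by
  rw [dunkl_apply, diffSign_X_mul_expand, dunklA_apply, Finset.sum_congr rfl fun k hk =>
    diffMinus_add_diffPlus_X_mul_expand (show j ≠ k by simp at hk; tauto) f, ← Finset.mul_sum,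
    Derivation.leibniz, pderiv_expand_two, Derivation.leibniz, pderiv_X_self, map_add, map_smul,
    map_smul, map_add, map_smul, map_sum, map_add, smul_eq_mul, smul_eq_mul, smul_eq_mul,
    smul_eq_mul, map_mul, expand_X]
  simp only [smul_eq_C_mul, map_sub, map_mul, map_ofNat, map_one]
  ring

/-- $D_j$ sends an even polynomial to $z_j$ times an even one, and the creation operator leads back;
on even polynomials $s_{jk}$ and $t_jt_ks_{jk}$ coincide, whence the common factor $2$. -/
theorem h_expand (β : ℕ) (γ : ℝ) (j : Fin N) (f : Poly N) :
    h β γ j (expand 2 f) = (2 : ℂ) • expand 2 (opA β γ j f) := by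
  have hs : (((Real.sqrt 2 : ℝ) : ℂ)⁻¹) * ((Real.sqrt 2 : ℝ) : ℂ)⁻¹ = 1 / 2 := by
    rw [← mul_inv, ← Complex.ofReal_mul, Real.mul_self_sqrt (by norm_num)]
    norm_num
  have e1 : (creation β γ j * annihilation β γ j) (expand 2 f) =
      (2 : ℂ) • expand 2 (quadA β γ j f) := by
    simp only [creation, annihilation, Module.End.mul_apply, LinearMap.smul_apply,
      LinearMap.add_apply, LinearMap.neg_apply, map_smul, mulOp, LinearMap.mulLeft_apply]
    rw [smul_smul, hs, dunkl_expand, show (2 : Poly N) * X j * expand 2 (dunklA β j f) =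
      (2 : ℂ) • (X j * expand 2 (dunklA β j f)) by
        simp only [smul_eq_C_mul, map_ofNat]; ring, map_smul, dunkl_X_mul_expand, quadA_apply,
      eulerA_apply]
    simp only [map_add, map_sub, map_smul, map_mul, expand_X]
    simp only [smul_eq_C_mul]
    have h2 : (C (1 / 2 : ℂ) : Poly N) * 2 = 1 := by
      rw [← map_ofNat C 2, ← C_mul]; norm_num
    simp only [map_sub, map_mul, map_one, map_ofNat]
    linear_combination (2 * expand 2 (dunklA β j f) * X j ^ 2 -
      2 * expand 2 (dunklA β j (X j * dunklA β j f)) - 2 * C (γ : ℂ) * expand 2 (dunklA β j f)) * h2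
  rw [h, LinearMap.add_apply, e1, opA_apply, map_add, smul_add, map_smul, map_sum]
  simp only [LinearMap.smul_apply, LinearMap.sum_apply, LinearMap.add_apply, Module.End.mul_apply,
    s_expand, t_expand, ← two_smul ℂ (expand 2 _), ← Finset.smul_sum]
  rw [smul_comm]

theorem yProd_expand (β : ℕ) (γ : ℝ) (c : ℂ) (f : Poly N) :
    yProd N β γ c (expand 2 f) = expand 2 (evalOp β γ (shiftPoly N c) f) := by
  -- The operator product is over a list, the polynomial one over a finset; `evalOp` is
  -- multiplicative, so the order is immaterial.
  have hp : shiftPoly N c = ((pairs N).map fun p => C c + X p.1 - X p.2).prod := by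
    have hnd : (pairs N).Nodup :=
      ((List.nodup_finRange N).product (List.nodup_finRange N)).filter _
    rw [shiftPoly, ← List.prod_toFinset _ hnd]
    congr 1
    ext ⟨a, b⟩
    simp [pairs]
  rw [hp, yProd]
  generalize pairs N = l
  induction l generalizing f with
  | nil => simp
  | cons p l ih =>
    rw [List.map_cons, List.prod_cons, List.map_cons, List.prod_cons, Module.End.mul_apply, ih,
      map_mul, Module.End.mul_apply]
    simp only [LinearMap.add_apply, LinearMap.sub_apply, LinearMap.smul_apply, h_expand, map_add,
      map_sub, evalOp_X, evalOp_C, Module.End.one_apply, smul_smul, map_smul]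
    norm_num

/-! ### Triangularity -/

/-- Exponent vectors whose sum over each index set `I` is at most `p |I|`. -/
def boundedExp (N : ℕ) (p : ℕ → ℕ) : Set (Fin N →₀ ℕ) :=
  {α | ∀ I : Finset (Fin N), ∑ i ∈ I, α i ≤ p I.card}

/-- Polynomials all of whose exponent vectors are bounded by `p`. -/
def boundedSub (N : ℕ) (p : ℕ → ℕ) : Submodule ℂ (Poly N) := restrictSupport ℂ (boundedExp N p)

theorem sum_erase_congr {f g : Fin N → ℕ} {a b : Fin N} (I : Finset (Fin N))
    (hfg : ∀ i, i ≠ a → i ≠ b → f i = g i) (ha : a ∉ I) (hb : b ∉ I) :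
    ∑ i ∈ I, f i = ∑ i ∈ I, g i :=
  Finset.sum_congr rfl fun i hi => hfg i (by rintro rfl; exact ha hi) (by rintro rfl; exact hb hi)

theorem sum_le_of_squeeze_one {f g : Fin N → ℕ} {a b : Fin N} {p : ℕ → ℕ}
    (hg : ∀ I : Finset (Fin N), ∑ i ∈ I, g i ≤ p I.card)
    (hfg : ∀ i, i ≠ a → i ≠ b → f i = g i) (hm : f a ≤ max (g a) (g b)) {I : Finset (Fin N)}
    (ha : a ∈ I) (hb : b ∉ I) : ∑ i ∈ I, f i ≤ p I.card := by
  have hb' : b ∉ I.erase a := fun e => hb (Finset.mem_of_mem_erase e)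
  rw [← Finset.add_sum_erase _ _ ha, sum_erase_congr _ hfg (by simp) hb']
  rcases le_max_iff.mp hm with e | e
  · have := hg I
    rw [← Finset.add_sum_erase _ _ ha] at this
    omega
  · have := hg (insert b (I.erase a))
    rw [Finset.sum_insert hb', Finset.card_insert_of_notMem hb', Finset.card_erase_add_one ha]
      at this
    omega

/-- If $I$ contains $a$ but not $b$, the bound for $f$ follows from that of $g$ on $I$ or on $I$
with $a$ replaced by $b$, which has the same cardinality. -/
theorem boundedExp_squeeze {p : ℕ → ℕ} {f g : Fin N →₀ ℕ} {a b : Fin N} (hab : a ≠ b)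
    (hg : g ∈ boundedExp N p) (hfg : ∀ i, i ≠ a → i ≠ b → f i = g i) (hs : f a + f b ≤ g a + g b)
    (hma : f a ≤ max (g a) (g b)) (hmb : f b ≤ max (g a) (g b)) : f ∈ boundedExp N p := by
  intro I
  by_cases ha : a ∈ I <;> by_cases hb : b ∈ I
  · have := hg I
    have hb' : b ∈ I.erase a := Finset.mem_erase.mpr ⟨hab.symm, hb⟩
    rw [← Finset.add_sum_erase _ _ ha, ← Finset.add_sum_erase _ _ hb'] at this ⊢
    rw [sum_erase_congr _ hfg (by simp) (by simp)]
    omega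
  · exact sum_le_of_squeeze_one hg hfg hma ha hb
  · exact sum_le_of_squeeze_one hg (fun i h1 h2 => hfg i h2 h1) (max_comm (g a) (g b) ▸ hmb) hb ha
  · rw [sum_erase_congr _ hfg ha hb]
    exact hg I

theorem boundedExp_mono {p : ℕ → ℕ} {f g : Fin N →₀ ℕ} (hg : g ∈ boundedExp N p) (hfg : f ≤ g) :
    f ∈ boundedExp N p := fun I => (Finset.sum_le_sum fun i _ => hfg i).trans (hg I)

theorem boundedExp_mapDomain {p : ℕ → ℕ} {f : Fin N →₀ ℕ} (hf : f ∈ boundedExp N p)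
    (w : Equiv.Perm (Fin N)) : f.mapDomain w ∈ boundedExp N p := by
  intro I
  have := hf (I.map w.symm.toEmbedding)
  rw [Finset.card_map, Finset.sum_map] at this
  simpa [Finsupp.mapDomain_equiv_apply] using this

theorem map_mem_of_monomial {A : Set (Fin N →₀ ℕ)} {M : Submodule ℂ (Poly N)}
    {T : Module.End ℂ (Poly N)} (hT : ∀ α ∈ A, T (monomial α 1) ∈ M) {f : Poly N}
    (hf : f ∈ restrictSupport ℂ A) : T f ∈ M := by
  rw [restrictSupport_eq_span] at hf
  have : Submodule.span ℂ ((fun α => monomial α (1 : ℂ)) '' A) ≤ M.comap T :=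
    Submodule.span_le.mpr (by rintro _ ⟨α, hα, rfl⟩; exact hT α hα)
  exact this hf

theorem X_mul_mem_restrictSupport {A B : Set (Fin N →₀ ℕ)} {l : Fin N}
    (hAB : ∀ α ∈ A, Finsupp.single l 1 + α ∈ B) {f : Poly N} (hf : f ∈ restrictSupport ℂ A) :
    X l * f ∈ restrictSupport ℂ B := by
  refine map_mem_of_monomial (T := mulOp (X l)) (fun α hα => ?_) hf
  rw [mulOp, LinearMap.mulLeft_apply, X, monomial_mul, one_mul]
  exact ((monomial_mem_restrictSupport ℂ).mpr <| Or.inl (hAB α hα))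

theorem rename_mem_boundedSub {p : ℕ → ℕ} {f : Poly N} (hf : f ∈ boundedSub N p)
    (w : Equiv.Perm (Fin N)) : rename w f ∈ boundedSub N p := by
  refine map_mem_of_monomial (T := (rename w).toLinearMap) (fun α hα => ?_) hf
  rw [AlgHom.toLinearMap_apply, rename_monomial]
  exact ((monomial_mem_restrictSupport ℂ).mpr <| Or.inl (boundedExp_mapDomain hα w))

/-- The exponent vectors occurring in a divided difference of the monomial `α`. -/
def squeezed (a b : Fin N) (α : Fin N →₀ ℕ) : Set (Fin N →₀ ℕ) :=
  {α' | (∀ i, i ≠ a → i ≠ b → α' i = α i) ∧ α' a + α' b + 1 = α a + α b ∧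
    α' a < max (α a) (α b) ∧ α' b < max (α a) (α b)}

theorem squeezed_swap (a b : Fin N) (α : Fin N →₀ ℕ) : squeezed a b α = squeezed b a α := by
  ext α'
  simp only [squeezed, Set.mem_ofPred_eq, max_comm (α b), add_comm (α b), add_comm (α' b)]
  exact ⟨fun h => ⟨fun i h1 h2 => h.1 i h2 h1, h.2.1, h.2.2.2, h.2.2.1⟩,
    fun h => ⟨fun i h1 h2 => h.1 i h2 h1, h.2.1, h.2.2.2, h.2.2.1⟩⟩

theorem diffMinus_monomial_of_le {a b : Fin N} (hab : a ≠ b) {α : Fin N →₀ ℕ} (hle : α b ≤ α a) :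
    diffMinus a b (monomial α 1) ∈ restrictSupport ℂ (squeezed a b α) := by
  set R := (α.erase a).erase b with hR
  set d := α a - α b with hd
  set n := α b with hn
  have hα : (monomial α (1 : ℂ) : Poly N) = monomial R 1 * (X a ^ (n + d) * X b ^ n) := by
    rw [X_pow_eq_monomial, X_pow_eq_monomial, monomial_mul, monomial_mul, one_mul, one_mul]
    refine congrArg (fun u => monomial u (1 : ℂ)) ?_
    ext i
    by_cases ha : i = a
    · subst ha; simp [hR, hab]; omega
    by_cases hb : i = b
    · subst hb; simp [hR, Ne.symm hab, hn]
    simp [hR, ha, hb]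
  have hs : s a b (monomial R (1 : ℂ)) = monomial R 1 := by
    rw [s_apply, rename_monomial]
    refine congrArg (fun u => monomial u (1 : ℂ)) ?_
    ext i
    rw [Finsupp.mapDomain_equiv_apply, Equiv.symm_swap]
    by_cases ha : i = a
    · subst ha; simp [hR, hab]
    by_cases hb : i = b
    · subst hb; simp [hR, hab]
    rw [Equiv.swap_apply_of_ne_of_ne ha hb]
  -- This is $(x_a^d-x_b^d)/(x_a-x_b)$ written as a geometric sum, times the factors fixed by
  -- $s_{ab}$.
  have e : diffMinus a b (monomial α 1) = ∑ r ∈ Finset.range d,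
      monomial R 1 * (X a ^ (n + r) * X b ^ (n + (d - 1 - r))) := by
    apply eq_diffMinus hab
    have hpow : ∀ (k : ℕ) (l : Fin N), s a b (X l ^ k : Poly N) = X (Equiv.swap a b l) ^ k := by
      intro k l; rw [s_apply, map_pow, rename_X]
    rw [hα, s_mul, s_mul, hs, hpow, hpow, Equiv.swap_apply_left, Equiv.swap_apply_right]
    have hg := geom_sum₂_mul (X a : Poly N) (X b) d
    have : ∑ r ∈ Finset.range d, monomial R (1 : ℂ) * (X a ^ (n + r) * X b ^ (n + (d - 1 - r))) =
        monomial R (1 : ℂ) * (X a ^ n * X b ^ n) *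
          ∑ r ∈ Finset.range d, X a ^ r * X b ^ (d - 1 - r) := by
      rw [Finset.mul_sum]
      exact Finset.sum_congr rfl fun r _ => by ring
    rw [this]
    linear_combination monomial R (1 : ℂ) * (X a ^ n * X b ^ n) * hg
  rw [e]
  refine Submodule.sum_mem _ fun r hr => ?_
  rw [X_pow_eq_monomial, X_pow_eq_monomial, monomial_mul, monomial_mul, one_mul, one_mul]
  refine ((monomial_mem_restrictSupport ℂ).mpr <| Or.inl ?_)
  have hr := Finset.mem_range.mp hr
  refine ⟨fun i ha hb => ?_, ?_, ?_, ?_⟩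
  · simp [hR, ha, hb]
  all_goals
    simp [hR, hab, Ne.symm hab]
    omega

theorem diffMinus_monomial {a b : Fin N} (hab : a ≠ b) (α : Fin N →₀ ℕ) :
    diffMinus a b (monomial α 1) ∈ restrictSupport ℂ (squeezed a b α) := by
  rcases le_total (α b) (α a) with hle | hle
  · exact diffMinus_monomial_of_le hab hle
  · rw [diffMinus_swap hab.symm, squeezed_swap]
    exact Submodule.neg_mem _ (diffMinus_monomial_of_le hab.symm hle)

/-- The strict inequalities in `squeezed` leave room for the extra factor $X_a$. -/
theorem X_mul_diffMinus_mem {p : ℕ → ℕ} {a b : Fin N} (hab : a ≠ b) {f : Poly N}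
    (hf : f ∈ boundedSub N p) : X a * diffMinus a b f ∈ boundedSub N p := by
  refine map_mem_of_monomial (T := mulOp (X a) * diffMinus a b) (fun α hα => ?_) hf
  refine X_mul_mem_restrictSupport (fun α' hα' => ?_) (diffMinus_monomial hab α)
  obtain ⟨h1, h2, h3, h4⟩ := hα'
  refine boundedExp_squeeze hab hα (fun i ha hb => ?_) ?_ ?_ ?_
  · simp [h1 i ha hb, Ne.symm ha]
  all_goals
    simp [hab.symm]
    omega

/-- Elements of `boundedExp` of total degree smaller than `p N`. -/
def boundedExpLT (N : ℕ) (p : ℕ → ℕ) : Set (Fin N →₀ ℕ) :=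
  {α | α ∈ boundedExp N p ∧ ∑ i, α i < p N}

theorem boundedExp_sum_le {p : ℕ → ℕ} {α : Fin N →₀ ℕ} (hα : α ∈ boundedExp N p) :
    ∑ i, α i ≤ p N := by simpa using hα Finset.univ

theorem diffMinus_mem {p : ℕ → ℕ} {a b : Fin N} (hab : a ≠ b) {f : Poly N}
    (hf : f ∈ boundedSub N p) : diffMinus a b f ∈ restrictSupport ℂ (boundedExpLT N p) := by
  refine map_mem_of_monomial (fun α hα => ?_) hf
  refine restrictSupport_mono ℂ (fun α' hα' => ?_) (diffMinus_monomial hab α)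
  obtain ⟨h1, h2, h3, h4⟩ := hα'
  refine ⟨boundedExp_squeeze hab hα h1 (by omega) h3.le h4.le, ?_⟩
  refine lt_of_lt_of_le ?_ (boundedExp_sum_le hα)
  have hb : b ∈ Finset.univ.erase a := by simp [hab.symm]
  rw [← Finset.add_sum_erase _ _ (Finset.mem_univ a), ← Finset.add_sum_erase _ _ hb,
    ← Finset.add_sum_erase _ _ (Finset.mem_univ a), ← Finset.add_sum_erase _ _ hb,
    sum_erase_congr _ h1 (by simp) (by simp)]
  omega

theorem pderiv_mem {p : ℕ → ℕ} (j : Fin N) {f : Poly N} (hf : f ∈ boundedSub N p) :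
    pderiv j f ∈ restrictSupport ℂ (boundedExpLT N p) := by
  refine map_mem_of_monomial (T := (pderiv j).toLinearMap) (fun α hα => ?_) hf
  show pderiv j _ ∈ _
  rw [pderiv_monomial]
  by_cases h0 : α j = 0
  · simp [h0]
  refine ((monomial_mem_restrictSupport ℂ).mpr <| Or.inl ⟨boundedExp_mono hα tsub_le_self, ?_⟩)
  refine lt_of_lt_of_le ?_ (boundedExp_sum_le hα)
  refine Finset.sum_lt_sum (fun i _ => ?_) ⟨j, Finset.mem_univ j, ?_⟩
  · simp
  · simp; omega

/-- $T_j$ lowers the total degree, so it contributes nothing to coefficients of the maximal degree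
$p(N)$. -/
theorem dunklA_mem_LT {p : ℕ → ℕ} (β : ℕ) (j : Fin N) {f : Poly N} (hf : f ∈ boundedSub N p) :
    dunklA β j f ∈ restrictSupport ℂ (boundedExpLT N p) := by
  rw [dunklA_apply]
  refine Submodule.add_mem _ (pderiv_mem j hf) (Submodule.smul_mem _ _ (Submodule.sum_mem _ ?_))
  intro k hk
  exact diffMinus_mem (by simp at hk; tauto) hf

theorem dunklA_mem {p : ℕ → ℕ} (β : ℕ) (j : Fin N) {f : Poly N} (hf : f ∈ boundedSub N p) :
    dunklA β j f ∈ boundedSub N p :=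
  restrictSupport_mono ℂ (fun _ h => h.1) (dunklA_mem_LT β j hf)

theorem X_mul_pderiv_mem {A : Set (Fin N →₀ ℕ)} (j : Fin N) {f : Poly N}
    (hf : f ∈ restrictSupport ℂ A) : X j * pderiv j f ∈ restrictSupport ℂ A := by
  refine map_mem_of_monomial (T := mulOp (X j) * (pderiv j).toLinearMap) (fun α hα => ?_) hf
  show X j * pderiv j _ ∈ _
  rw [X_mul_pderiv_monomial]
  exact nsmul_mem (((monomial_mem_restrictSupport ℂ).mpr <| Or.inl hα)) _

theorem eulerA_eq (β : ℕ) (j : Fin N) (f : Poly N) : eulerA β j f = X j * pderiv j f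
    + (β : ℂ) • ∑ k ∈ Finset.univ.filter (fun k => k ≠ j), X j * diffMinus j k f := by
  rw [eulerA_apply, dunklA_apply, mul_add, mul_smul_comm, Finset.mul_sum]

theorem eulerA_mem {p : ℕ → ℕ} (β : ℕ) (j : Fin N) {f : Poly N} (hf : f ∈ boundedSub N p) :
    eulerA β j f ∈ boundedSub N p := by
  rw [eulerA_eq]
  refine Submodule.add_mem _ (X_mul_pderiv_mem j hf)
    (Submodule.smul_mem _ _ (Submodule.sum_mem _ ?_))
  intro k hk
  exact X_mul_diffMinus_mem (by simp at hk; tauto) hf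

theorem opA_mem {p : ℕ → ℕ} (β : ℕ) (γ : ℝ) (j : Fin N) {f : Poly N} (hf : f ∈ boundedSub N p) :
    opA β γ j f ∈ boundedSub N p := by
  rw [opA_apply, quadA_apply]
  have hw := eulerA_mem β j hf
  refine Submodule.add_mem _ (Submodule.sub_mem _ (Submodule.sub_mem _ hw (dunklA_mem β j hw))
    (Submodule.smul_mem _ _ (dunklA_mem β j hf))) (Submodule.smul_mem _ _ (Submodule.sum_mem _ ?_))
  intro k _
  exact rename_mem_boundedSub hf _

theorem evalOp_mem {p : ℕ → ℕ} (β : ℕ) (γ : ℝ) (q : Poly N) {f : Poly N}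
    (hf : f ∈ boundedSub N p) : evalOp β γ q f ∈ boundedSub N p := by
  induction q using MvPolynomial.induction_on with
  | C a => rw [evalOp_C]; exact Submodule.smul_mem _ _ hf
  | add q r hq hr => rw [map_add]; exact Submodule.add_mem _ hq hr
  | mul_X q k ih => rw [evalOp_X_mul']; exact opA_mem β γ k ih

/-- An exponent vector whose final segments attain the bound `p`. -/
structure IsExtremal (p : ℕ → ℕ) (α : Fin N →₀ ℕ) : Prop where
  total : ∑ i, α i = p N
  tail : ∀ m : Fin N, ∑ i ∈ Finset.Ici m, α i = p (Finset.Ici m).card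

theorem coeff_eq_zero_of_mem {A : Set (Fin N →₀ ℕ)} {f : Poly N} (hf : f ∈ restrictSupport ℂ A)
    {α : Fin N →₀ ℕ} (hα : α ∉ A) : coeff α f = 0 := by
  by_contra hc
  exact hα ((mem_restrictSupport_iff ℂ).mp hf (mem_support_iff.mpr hc))

theorem IsExtremal.coeff_dunklA {p : ℕ → ℕ} {α : Fin N →₀ ℕ} (hα : IsExtremal p α) (β : ℕ)
    (j : Fin N) {f : Poly N} (hf : f ∈ boundedSub N p) : coeff α (dunklA β j f) = 0 :=
  coeff_eq_zero_of_mem (dunklA_mem_LT β j hf) fun h => h.2.ne hα.total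

/-- To reach $\alpha$, the entry at $m$ must come from a monomial $\alpha_1$ with a larger entry at
$l$ or $m$. Together with the positions after $m$ this would exceed the bound, which $\alpha$
already attains on the final segment. -/
theorem IsExtremal.coeff_X_mul_diffMinus {p : ℕ → ℕ} {α : Fin N →₀ ℕ} (hα : IsExtremal p α)
    {l m : Fin N} (hlm : l < m) {f : Poly N} (hf : f ∈ boundedSub N p) :
    coeff α (X l * diffMinus l m f) = 0 := by
  refine coeff_eq_zero_of_mem (A := {α}ᶜ) ?_ (by simp)
  refine map_mem_of_monomial (T := mulOp (X l) * diffMinus l m) (fun α₁ hα₁ => ?_) hf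
  refine X_mul_mem_restrictSupport (fun α' hα' => ?_) (diffMinus_monomial hlm.ne α₁)
  obtain ⟨h1, h2, h3, h4⟩ := hα'
  simp only [Set.mem_compl_iff, Set.mem_singleton_iff]
  intro e
  have hoff : ∀ i, i ≠ l → i ≠ m → α i = α₁ i := fun i hl hm => by
    rw [← e, ← h1 i hl hm]; simp [Ne.symm hl]
  have hm : α m = α' m := by rw [← e]; simp [hlm.ne]
  have htail := hα.tail m
  have hmem : m ∈ Finset.Ici m := Finset.mem_Ici.mpr le_rfl
  have hl : l ∉ (Finset.Ici m).erase m := by simp [hlm.le]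
  rw [← Finset.add_sum_erase _ _ hmem, sum_erase_congr _ hoff hl (by simp)] at htail
  rcases lt_max_iff.mp h4 with h5 | h5
  · have := hα₁ (insert l ((Finset.Ici m).erase m))
    rw [Finset.sum_insert hl, Finset.card_insert_of_notMem hl, Finset.card_erase_add_one hmem]
      at this
    omega
  · have := hα₁ (Finset.Ici m)
    rw [← Finset.add_sum_erase _ _ hmem] at this
    omega

theorem coeff_X_mul_pderiv (α : Fin N →₀ ℕ) (j : Fin N) (f : Poly N) :
    coeff α (X j * pderiv j f) = α j * coeff α f := by
  induction f using MvPolynomial.induction_on' with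
  | monomial u a =>
    rw [X_mul_pderiv_monomial, coeff_smul, coeff_monomial]
    split_ifs with hu <;> simp [hu]
  | add p q hp hq => rw [map_add, mul_add, coeff_add, hp, hq, coeff_add]; ring

/-- Lower-degree terms and the differences with $k>j$ drop out, and the Euler part gives $\alpha_j$.
Each of the $j$ indices $k<j$ (counted from $0$) gives one $\beta$. -/
theorem IsExtremal.coeff_opA {p : ℕ → ℕ} {α : Fin N →₀ ℕ} (hα : IsExtremal p α) (β : ℕ) (γ : ℝ)
    (j : Fin N) {f : Poly N} (hf : f ∈ boundedSub N p) :
    coeff α (opA β γ j f) = (α j + β * (j : ℕ)) * coeff α f := by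
  have hsplit : Finset.univ.filter (fun k => k ≠ j) =
      (Finset.univ.filter (fun k => k < j)) ∪ Finset.univ.filter (fun k => j < k) := by
    ext k; simp [lt_or_lt_iff_ne]
  have hdisj : Disjoint (Finset.univ.filter (fun k => k < j))
      (Finset.univ.filter (fun k => j < k)) := by
    rw [Finset.disjoint_filter]; intro k _ h1 h2; exact lt_asymm h1 h2
  -- As $x_k\,$`diffMinus` has coefficient zero, $x_j\,$`diffMinus` has the same coefficient as
  -- $f-s_{jk}f$; the reflection term of `opA` restores $s_{jk}f$.
  have hlt : ∀ k ∈ Finset.univ.filter (fun k => k < j),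
      coeff α (X j * diffMinus j k f) + coeff α (s j k f) = coeff α f := by
    intro k hk
    have hk : k < j := by simpa using hk
    have e1 := hα.coeff_X_mul_diffMinus hk hf
    rw [diffMinus_swap hk.ne', mul_neg, coeff_neg, neg_eq_zero] at e1
    have e2 := congrArg (coeff α) (mul_diffMinus hk.ne' f)
    rw [sub_mul, coeff_sub, coeff_sub, e1] at e2
    linear_combination e2
  have hcard : (Finset.univ.filter (fun k : Fin N => k < j)).card = j := by
    rw [Finset.filter_gt_eq_Iio, Fin.card_Iio]
  rw [opA_apply, quadA_apply, coeff_add, coeff_sub, coeff_sub, coeff_smul, coeff_smul,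
    hα.coeff_dunklA β j (eulerA_mem β j hf), hα.coeff_dunklA β j hf, eulerA_eq, coeff_add,
    coeff_X_mul_pderiv, coeff_smul, coeff_sum, coeff_sum, hsplit, Finset.sum_union hdisj,
    Finset.sum_eq_zero (s := Finset.univ.filter (fun k => j < k)) fun k hk =>
      hα.coeff_X_mul_diffMinus (by simpa using hk) hf]
  have := Finset.sum_congr rfl hlt
  rw [Finset.sum_add_distrib, Finset.sum_const, hcard, nsmul_eq_mul] at this
  simp only [smul_eq_mul]
  linear_combination (β : ℂ) * this

theorem IsExtremal.coeff_evalOp {p : ℕ → ℕ} {α : Fin N →₀ ℕ} (hα : IsExtremal p α) (β : ℕ) (γ : ℝ)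
    (q : Poly N) {f : Poly N} (hf : f ∈ boundedSub N p) :
    coeff α (evalOp β γ q f) =
      eval (fun j : Fin N => (α j + β * (j : ℕ) : ℂ)) q * coeff α f := by
  induction q using MvPolynomial.induction_on with
  | C a => simp
  | add q r hq hr => rw [map_add, LinearMap.add_apply, coeff_add, hq, hr, map_add]; ring
  | mul_X q k ih =>
    rw [evalOp_X_mul', hα.coeff_opA β γ k (evalOp_mem β γ q hf), ih, map_mul, eval_X]
    ring

/-! ### The Vandermonde polynomial -/

/-- `∏_{i<j} (X_i - X_j)`. -/
def vand (N : ℕ) : Poly N := shiftPoly N 0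

theorem vand_eq_prod : vand N =
    ∏ p ∈ Finset.univ.filter (fun p : Fin N × Fin N => p.1 < p.2), (X p.1 - X p.2) := by
  simp [vand, shiftPoly]

theorem expand_vand : expand 2 (vand N) = polyX N := by
  simp [vand_eq_prod, polyX]

theorem vand_ne_zero : vand N ≠ 0 := by
  rw [vand_eq_prod]
  exact Finset.prod_ne_zero_iff.mpr fun p hp => X_sub_X_ne_zero (by simpa using hp : p.1 < p.2).ne

theorem isAntisymmetric_vand : IsAntisymmetric (vand N) := by
  refine isAntisymmetric_of_adjacent fun a b hab => ?_
  rw [vand, shiftPoly_eq 0 (Fin.lt_def.mpr (by omega) : a < b), s_mul, s_shiftPolyErase 0 hab]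
  simp [s_X]
  ring

theorem isAntisymmetric_vand_mul {g : Poly N} (hg : g.IsSymmetric) :
    IsAntisymmetric (vand N * g) := fun w => by
  rw [map_mul, isAntisymmetric_vand, hg w, smul_mul_assoc]

theorem isSymmetric_of_vand_mul {g : Poly N} (hg : IsAntisymmetric (vand N * g)) :
    g.IsSymmetric := fun w => by
  have h1 := hg w
  rw [map_mul, isAntisymmetric_vand, smul_mul_assoc] at h1
  have hc : ((Equiv.Perm.sign w : ℤ) : ℂ) ≠ 0 := by simp
  exact mul_left_cancel₀ vand_ne_zero (smul_right_injective _ hc h1)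

/-- The substitution `X_k ↦ X_l`. -/
def identify (k l : Fin N) : Poly N →ₐ[ℂ] Poly N := aeval (Function.update X k (X l))

/-- Modulo $X_k-X_l$ the substitution is the identity. Its kernel is thus this principal ideal, and
primality follows since the target is a domain. -/
theorem X_sub_X_dvd_iff {k l : Fin N} (f : Poly N) :
    X k - X l ∣ f ↔ identify k l f = 0 := by
  constructor
  · rintro ⟨g, rfl⟩
    rcases eq_or_ne k l with rfl | hkl
    · simp
    · simp [identify, Ne.symm hkl]
  · intro h0
    have := dvd_sub_algHom (X k - X l) (identify k l) (fun i => ?_) f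
    · rwa [h0, sub_zero] at this
    · rcases eq_or_ne i k with rfl | hik
      · simp [identify]
      · simp [identify, hik]

theorem prime_X_sub_X {k l : Fin N} (hkl : k ≠ l) : Prime (X k - X l : Poly N) := by
  refine ⟨X_sub_X_ne_zero hkl, fun hu => ?_, fun f g hfg => ?_⟩
  · have := (X_sub_X_dvd_iff (1 : Poly N)).mp hu.dvd
    simp at this
  · rw [X_sub_X_dvd_iff, map_mul, mul_eq_zero] at hfg
    simpa only [X_sub_X_dvd_iff] using hfg

theorem not_X_sub_X_dvd {i j k l : Fin N} (hij : i < j) (hkl : k < l) (hne : (i, j) ≠ (k, l)) :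
    ¬ (X i - X j : Poly N) ∣ X k - X l := by
  rw [X_sub_X_dvd_iff, map_sub, identify, aeval_X, aeval_X, sub_eq_zero]
  intro e
  have e' : Function.update (fun x : Fin N => x) i j k =
      Function.update (fun x : Fin N => x) i j l := by
    apply X_injective (R := ℂ)
    by_cases hk : k = i <;> by_cases hl : l = i <;>
      simp_all
  simp only [Function.update_apply] at e'
  split_ifs at e' with h1 h2 h2
  · omega
  · subst h1; subst e'; exact hne rfl
  · subst h2; subst e'; exact absurd (hij.trans hkl) (lt_irrefl _)
  · omega

/-- Each $X_i-X_j$ divides $f-s_{ij}f=2f$, and these factors are pairwise coprime. -/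
theorem IsAntisymmetric.vand_dvd {f : Poly N} (hf : IsAntisymmetric f) : vand N ∣ f := by
  rw [vand_eq_prod]
  refine Finset.prod_dvd_of_isRelPrime ?_ ?_
  · intro p hp q hq hpq
    have hp : p.1 < p.2 := by simpa using hp
    have hq : q.1 < q.2 := by simpa using hq
    exact (prime_X_sub_X hp.ne).irreducible.isRelPrime_iff_not_dvd.mpr (not_X_sub_X_dvd hp hq hpq)
  · intro p hp
    have hp : p.1 < p.2 := by simpa using hp
    have h1 := mul_diffMinus hp.ne f
    rw [hf.s_eq hp.ne, sub_neg_eq_add, ← two_smul ℂ] at h1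
    refine ⟨(2 : ℂ)⁻¹ • diffMinus p.1 p.2 f, ?_⟩
    rw [mul_smul_comm, h1, smul_smul]
    norm_num

/-! ### Degrees with respect to a set of variables -/

/-- The substitution `X_i ↦ t X_i` for `i ∈ I`. -/
def scaleHom (I : Finset (Fin N)) : Poly N →ₐ[ℂ] Polynomial (Poly N) :=
  aeval fun i => if i ∈ I then Polynomial.C (X i) * Polynomial.X else Polynomial.C (X i)

theorem scaleHom_monomial (I : Finset (Fin N)) (α : Fin N →₀ ℕ) (c : ℂ) :
    scaleHom I (monomial α c) = Polynomial.C (monomial α c) * Polynomial.X ^ (∑ i ∈ I, α i) := by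
  rw [scaleHom, aeval_monomial, monomial_eq, map_mul, Finsupp.prod_fintype _ _ (by simp),
    Finsupp.prod_fintype _ _ (by simp), map_prod, mul_assoc]
  have e : ∀ i, (if i ∈ I then Polynomial.C (X i : Poly N) * Polynomial.X else Polynomial.C (X i)) ^ α i
      = Polynomial.C (X i ^ α i) * if i ∈ I then Polynomial.X ^ α i else 1 := by
    intro i
    split_ifs <;> simp [mul_pow]
  rw [Finset.prod_congr rfl fun i _ => e i, Finset.prod_mul_distrib, Finset.prod_ite_mem,
    Finset.univ_inter, Finset.prod_pow_eq_pow_sum]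
  rfl

theorem coeff_coeff_scaleHom (I : Finset (Fin N)) (f : Poly N) (n : ℕ) (α : Fin N →₀ ℕ) :
    coeff α ((scaleHom I f).coeff n) = if ∑ i ∈ I, α i = n then coeff α f else 0 := by
  induction f using MvPolynomial.induction_on' with
  | monomial u a =>
    rw [scaleHom_monomial, Polynomial.coeff_C_mul, Polynomial.coeff_X_pow, coeff_monomial]
    by_cases hu : u = α
    · subst hu
      simp only [if_true, mul_ite, mul_one, mul_zero, eq_comm (a := n)]
      split_ifs <;> simp
    · split_ifs <;> simp [hu]
  | add p q hp hq =>
    rw [map_add, Polynomial.coeff_add, coeff_add, hp, hq, coeff_add]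
    split_ifs <;> simp

theorem natDegree_scaleHom_le_iff (I : Finset (Fin N)) (f : Poly N) (n : ℕ) :
    (scaleHom I f).natDegree ≤ n ↔ ∀ α ∈ f.support, ∑ i ∈ I, α i ≤ n := by
  rw [Polynomial.natDegree_le_iff_coeff_eq_zero]
  constructor
  · intro h0 α hα
    by_contra hlt
    have := coeff_coeff_scaleHom I f (∑ i ∈ I, α i) α
    rw [h0 _ (not_le.mp hlt), if_pos rfl, coeff_zero] at this
    exact mem_support_iff.mp hα this.symm
  · intro h0 m hm
    ext α
    rw [coeff_coeff_scaleHom, coeff_zero]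
    split_ifs with he
    · by_contra hc
      have := h0 α (mem_support_iff.mpr hc)
      omega
    · rfl

theorem scaleHom_ne_zero (I : Finset (Fin N)) {f : Poly N} (hf : f ≠ 0) : scaleHom I f ≠ 0 := by
  obtain ⟨α, hα⟩ := ne_zero_iff.mp hf
  intro e
  have := coeff_coeff_scaleHom I f (∑ i ∈ I, α i) α
  rw [e, if_pos rfl, Polynomial.coeff_zero, coeff_zero] at this
  exact hα this.symm

theorem natDegree_scaleHom_X_sub_X (I : Finset (Fin N)) {i j : Fin N} (hij : i ≠ j) :
    (scaleHom I (X i - X j)).natDegree = if i ∈ I ∨ j ∈ I then 1 else 0 := by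
  have e : scaleHom I (X i - X j) =
      Polynomial.C ((if i ∈ I then X i else 0) - (if j ∈ I then X j else 0)) * Polynomial.X
      + Polynomial.C ((if i ∈ I then 0 else X i) - (if j ∈ I then 0 else X j)) := by
    rw [map_sub, scaleHom, aeval_X, aeval_X]
    split_ifs <;> simp <;> ring
  rw [e]
  by_cases h1 : i ∈ I <;> by_cases h2 : j ∈ I
  · simp only [h1, h2, if_true, or_self]
    exact Polynomial.natDegree_linear (X_sub_X_ne_zero hij)
  · simp only [h1, h2, if_true, if_false, or_false, sub_zero]
    exact Polynomial.natDegree_linear (X_ne_zero i)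
  · simp only [h1, h2, if_true, if_false, or_true, zero_sub]
    exact Polynomial.natDegree_linear (neg_ne_zero.mpr (X_ne_zero j))
  · simp only [h1, h2, if_false, or_self, sub_zero, map_zero, zero_mul, zero_add]
    exact Polynomial.natDegree_C _

/-- The partial sum `ν_1 + ⋯ + ν_k`. -/
def psum (ν : Fin N → ℕ) (k : ℕ) : ℕ :=
  ∑ i ∈ Finset.univ.filter (fun i : Fin N => (i : ℕ) < k), ν i

theorem psum_zero (ν : Fin N → ℕ) : psum ν 0 = 0 := by simp [psum]

theorem psum_succ (ν : Fin N → ℕ) {k : ℕ} (hk : k < N) :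
    psum ν (k + 1) = psum ν k + ν ⟨k, hk⟩ := by
  have e : Finset.univ.filter (fun i : Fin N => (i : ℕ) < k + 1) =
      insert ⟨k, hk⟩ (Finset.univ.filter (fun i : Fin N => (i : ℕ) < k)) := by
    ext i
    simp only [Finset.mem_filter, Finset.mem_univ, true_and, Finset.mem_insert, Fin.ext_iff]
    omega
  rw [psum, e, Finset.sum_insert (by simp), add_comm]
  rfl

/-- `δ = (N-1, N-2, …, 0)`. -/
def staircase (N : ℕ) : Fin N → ℕ := fun i => N - 1 - (i : ℕ)

theorem card_pairs_meeting (I : Finset (Fin N)) :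
    ((Finset.univ.filter (fun p : Fin N × Fin N => p.1 < p.2)).filter
      (fun p => p.1 ∈ I ∨ p.2 ∈ I)).card = psum (staircase N) I.card := by
  induction I using Finset.induction with
  | empty => simp [psum_zero]
  | insert a I ha ih =>
    have hcard : I.card < N := by
      have := Finset.card_lt_univ_of_notMem ha
      simpa using this
    -- The new pairs join $a$ to the $N-1-|I|$ indices outside $I\cup\{a\}$.
    have e : (Finset.univ.filter (fun p : Fin N × Fin N => p.1 < p.2)).filter
        (fun p => p.1 ∈ insert a I ∨ p.2 ∈ insert a I) =
        (Finset.univ.filter (fun p : Fin N × Fin N => p.1 < p.2)).filter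
          (fun p => p.1 ∈ I ∨ p.2 ∈ I) ∪
        (Finset.univ \ insert a I).image (fun b => if a < b then (a, b) else (b, a)) := by
      ext ⟨i, j⟩
      simp only [Finset.mem_filter, Finset.mem_univ, true_and, Finset.mem_insert, Finset.mem_union,
        Finset.mem_image, Finset.mem_sdiff, not_or]
      constructor
      · rintro ⟨hij, h1⟩
        by_cases h2 : i ∈ I ∨ j ∈ I
        · exact Or.inl ⟨hij, h2⟩
        · right
          rw [not_or] at h2
          rcases h1 with (rfl | h1) | (rfl | h1)
          · exact ⟨j, ⟨hij.ne', h2.2⟩, by simp [hij]⟩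
          · exact absurd h1 h2.1
          · exact ⟨i, ⟨hij.ne, h2.1⟩, by simp [hij.le]⟩
          · exact absurd h1 h2.2
      · rintro (⟨hij, h1⟩ | ⟨b, ⟨hb, hbI⟩, he⟩)
        · exact ⟨hij, by tauto⟩
        · split_ifs at he with hab
          · obtain ⟨rfl, rfl⟩ := Prod.mk.inj he
            exact ⟨hab, Or.inl (Or.inl rfl)⟩
          · obtain ⟨rfl, rfl⟩ := Prod.mk.inj he
            exact ⟨lt_of_le_of_ne (not_lt.mp hab) hb, Or.inr (Or.inl rfl)⟩
    rw [e, Finset.card_union_of_disjoint, ih, Finset.card_image_of_injOn,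
      Finset.card_sdiff_of_subset (Finset.subset_univ _), Finset.card_insert_of_notMem ha,
      psum_succ _ hcard, Finset.card_univ, Fintype.card_fin, staircase]
    · simp only
      omega
    · intro b _ c _ hbc
      simp only at hbc
      split_ifs at hbc <;> simp_all
    · rw [Finset.disjoint_left]
      rintro ⟨i, j⟩ h1 h2
      simp only [Finset.mem_filter, Finset.mem_univ, true_and, Finset.mem_insert,
        Finset.mem_image, Finset.mem_sdiff, not_or] at h1 h2
      obtain ⟨b, ⟨_, hbI⟩, he⟩ := h2
      split_ifs at he <;> obtain ⟨rfl, rfl⟩ := Prod.mk.inj he <;> tauto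

theorem natDegree_scaleHom_vand (I : Finset (Fin N)) :
    (scaleHom I (vand N)).natDegree = psum (staircase N) I.card := by
  rw [vand_eq_prod, map_prod, Polynomial.natDegree_prod, ← card_pairs_meeting,
    Finset.card_filter]
  · exact Finset.sum_congr rfl fun p hp =>
      natDegree_scaleHom_X_sub_X I (by simpa using hp : p.1 < p.2).ne
  · exact fun p hp => scaleHom_ne_zero I (X_sub_X_ne_zero (by simpa using hp : p.1 < p.2).ne)

/-- The degree in the variables of $I$ is additive on products over a domain, and for $V$ it is the
number of pairs meeting $I$. This permits division by $V$ without loss in the bounds. -/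
theorem vand_mul_mem_iff {p : ℕ → ℕ} (g : Poly N) : vand N * g ∈ boundedSub N p ↔
    ∀ α ∈ g.support, ∀ I : Finset (Fin N),
      ∑ i ∈ I, α i + psum (staircase N) I.card ≤ p I.card := by
  rcases eq_or_ne g 0 with rfl | hg
  · simp
  have h1 : vand N * g ∈ boundedSub N p ↔
      ∀ I : Finset (Fin N), (scaleHom I (vand N * g)).natDegree ≤ p I.card := by
    simp only [natDegree_scaleHom_le_iff, boundedSub, mem_restrictSupport_iff, Set.subset_def,
      boundedExp, Set.mem_ofPred_eq, Finset.mem_coe]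
    exact ⟨fun h I α hα => h α hα I, fun h α hα I => h I α hα⟩
  rw [h1]
  have hdeg : ∀ I : Finset (Fin N), (scaleHom I (vand N * g)).natDegree =
      psum (staircase N) I.card + (scaleHom I g).natDegree := fun I => by
    rw [map_mul, Polynomial.natDegree_mul (scaleHom_ne_zero I vand_ne_zero)
      (scaleHom_ne_zero I hg), natDegree_scaleHom_vand]
  constructor
  · intro h α hα I
    have h2 := h I
    rw [hdeg] at h2
    have := (natDegree_scaleHom_le_iff I g _).mp le_rfl α hα
    omega
  · intro h I
    -- One exponent of $g$ suffices to show that the natural subtraction below is not truncated.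
    obtain ⟨α, hα⟩ := support_nonempty.mpr hg
    have h3 := h α hα I
    rw [hdeg, ← Nat.le_sub_iff_add_le' (by omega), natDegree_scaleHom_le_iff]
    intro α hα
    have := h α hα I
    omega

/-! ### Partitions and symmetric polynomials -/

/-- A function on `Fin N` as an exponent vector. -/
def expo (ν : Fin N → ℕ) : Fin N →₀ ℕ := Finsupp.equivFunOnFinite.symm ν

@[simp] theorem expo_apply (ν : Fin N → ℕ) (i : Fin N) : expo ν i = ν i := rfl

theorem expo_coe (α : Fin N →₀ ℕ) : expo ⇑α = α := Finsupp.ext fun _ => rfl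

theorem expo_injective : Function.Injective (expo (N := N)) := Equiv.injective _

theorem coeff_rename_expo (w : Equiv.Perm (Fin N)) (ν : Fin N → ℕ) (f : Poly N) :
    coeff (expo ν) (rename w f) = coeff (expo (ν ∘ w)) f := by
  rw [← coeff_rename_mapDomain w w.injective f (expo (ν ∘ w))]
  refine congrArg (fun α => coeff α (rename w f)) (Finsupp.ext fun i => ?_)
  simp [Finsupp.mapDomain_equiv_apply]

theorem _root_.MvPolynomial.IsSymmetric.coeff_expo_comp {f : Poly N} (hf : f.IsSymmetric)
    (w : Equiv.Perm (Fin N)) (ν : Fin N → ℕ) : coeff (expo (ν ∘ w)) f = coeff (expo ν) f := by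
  rw [← coeff_rename_expo, hf w]

theorem IsAntisymmetric.coeff_expo_comp {f : Poly N} (hf : IsAntisymmetric f)
    (w : Equiv.Perm (Fin N)) (ν : Fin N → ℕ) :
    coeff (expo (ν ∘ w)) f = ((Equiv.Perm.sign w : ℤ) : ℂ) * coeff (expo ν) f := by
  rw [← coeff_rename_expo, hf w, coeff_smul, smul_eq_mul]

theorem prod_X_pow_eq (ν : Fin N → ℕ) : (∏ i, X i ^ ν i : Poly N) = monomial (expo ν) 1 := by
  rw [monomial_eq, Finsupp.prod_fintype _ _ (by simp), map_one, one_mul]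
  rfl

theorem coeff_mSymm (μ ν : Fin N → ℕ) : coeff (expo ν) (mSymm μ) =
    if ∃ w : Equiv.Perm (Fin N), μ ∘ w = ν then 1 else 0 := by
  classical
  rw [mSymm, coeff_sum]
  simp only [prod_X_pow_eq, coeff_monomial, expo_injective.eq_iff]
  rw [Finset.sum_ite_eq' _ ν (fun _ => (1 : ℂ))]
  simp

theorem isSymmetric_mSymm (μ : Fin N → ℕ) : (mSymm μ).IsSymmetric := by
  intro w
  ext α
  rw [← expo_coe α, coeff_rename_expo, coeff_mSymm, coeff_mSymm]
  congr 1
  refine propext ⟨?_, ?_⟩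
  · rintro ⟨v, hv⟩
    refine ⟨v * w⁻¹, ?_⟩
    rw [Equiv.Perm.coe_mul, ← Function.comp_assoc, hv]
    ext i; simp
  · rintro ⟨v, hv⟩
    exact ⟨v * w, by rw [Equiv.Perm.coe_mul, ← Function.comp_assoc, hv]⟩

theorem exists_antitone_comp (ν : Fin N → ℕ) :
    ∃ w : Equiv.Perm (Fin N), Antitone (ν ∘ w) := by
  refine ⟨Tuple.sort ν * Fin.revPerm, ?_⟩
  rw [Equiv.Perm.coe_mul, ← Function.comp_assoc]
  exact (Tuple.monotone_sort ν).comp_antitone fun i j hij => Fin.rev_le_rev.mpr hij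

theorem eq_of_antitone_comp {κ μ : Fin N → ℕ} (hκ : Antitone κ) (hμ : Antitone μ)
    {w : Equiv.Perm (Fin N)} (hw : κ ∘ w = μ) : κ = μ := by
  have := Tuple.unique_antitone (f := κ) (σ := 1) (τ := w) (by simpa using hκ) (by rwa [hw])
  rwa [hw] at this

theorem _root_.MvPolynomial.IsSymmetric.mem_span_mSymm {g : Poly N} (hg : g.IsSymmetric) :
    g ∈ Submodule.span ℂ {q : Poly N | ∃ κ : Fin N → ℕ, Antitone κ ∧ expo κ ∈ g.support ∧
      q = mSymm κ} := by
  classical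
  set K := (g.support.image fun α : Fin N →₀ ℕ => (⇑α : Fin N → ℕ)).filter Antitone with hK
  have hmem : ∀ κ : Fin N → ℕ, κ ∈ K ↔ expo κ ∈ g.support ∧ Antitone κ := by
    intro κ
    rw [hK, Finset.mem_filter, Finset.mem_image]
    refine and_congr_left fun _ => ⟨?_, fun h => ⟨_, h, rfl⟩⟩
    rintro ⟨α, hα, rfl⟩
    rwa [expo_coe]
  have e : g = ∑ κ ∈ K, coeff (expo κ) g • mSymm κ := by
    ext α
    obtain ⟨w, hw⟩ := exists_antitone_comp (⇑α : Fin N → ℕ)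
    rw [← expo_coe α, coeff_sum, ← hg.coeff_expo_comp w]
    simp only [coeff_smul, coeff_mSymm, smul_eq_mul]
    rw [Finset.sum_eq_single (⇑α ∘ w)]
    · rw [if_pos ⟨w⁻¹, by ext i; simp⟩, mul_one]
    · intro κ hκ hne
      rw [if_neg, mul_zero]
      rintro ⟨v, hv⟩
      refine hne (eq_of_antitone_comp ((hmem κ).mp hκ).2 hw (w := v * w) ?_)
      rw [Equiv.Perm.coe_mul, ← Function.comp_assoc, hv]
    · intro hn
      rw [hmem, not_and] at hn
      have : coeff (expo (⇑α ∘ w)) g = 0 := by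
        by_contra hc
        exact hn (mem_support_iff.mpr hc) hw
      rw [this, zero_mul]
  rw [e]
  refine Submodule.sum_mem _ fun κ hκ => Submodule.smul_mem _ _ (Submodule.subset_span ?_)
  rw [← e]
  exact ⟨κ, ((hmem κ).mp hκ).2, ((hmem κ).mp hκ).1, rfl⟩

/-! ### Partial sums and the dominance order -/

theorem antitone_sum_le {ν : Fin N → ℕ} (hν : Antitone ν) (I : Finset (Fin N)) :
    ∑ i ∈ I, ν i ≤ psum ν I.card := by
  induction I using Finset.induction_on_max with
  | empty => simp
  | insert a I ha ih =>
    have hn : a ∉ I := fun h => lt_irrefl _ (ha a h)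
    have hcard : I.card ≤ (a : ℕ) := by
      have : I ⊆ Finset.Iio a := fun x hx => Finset.mem_Iio.mpr (ha x hx)
      simpa using Finset.card_le_card this
    have hN : I.card < N := lt_of_le_of_lt hcard a.2
    rw [Finset.sum_insert hn, Finset.card_insert_of_notMem hn, psum_succ _ hN]
    have : ν a ≤ ν ⟨I.card, hN⟩ := hν hcard
    omega

theorem card_filter_val_lt {k : ℕ} (hk : k ≤ N) :
    (Finset.univ.filter (fun i : Fin N => (i : ℕ) < k)).card = k := by
  rw [Fin.card_filter_val_lt, min_eq_right hk]

theorem psum_of_ge (ν : Fin N → ℕ) {k : ℕ} (hk : N ≤ k) : psum ν k = psum ν N := by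
  rw [psum, psum]
  congr 1
  ext i
  simp only [Finset.mem_filter, Finset.mem_univ, true_and]
  omega

theorem psum_add (μ ν : Fin N → ℕ) (k : ℕ) : psum (μ + ν) k = psum μ k + psum ν k :=
  Finset.sum_add_distrib

theorem eq_of_psum_eq {μ ν : Fin N → ℕ} (h0 : ∀ k, psum μ k = psum ν k) : μ = ν := by
  ext i
  have h1 := h0 (i + 1)
  rw [psum_succ μ i.2, psum_succ ν i.2, h0 i] at h1
  simpa using h1

theorem sum_Iic_eq_psum (ν : Fin N → ℕ) (k : Fin N) :
    ∑ i ∈ Finset.Iic k, ν i = psum ν (k + 1) := by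
  rw [psum]
  congr 1
  ext i
  simp only [Finset.mem_Iic, Finset.mem_filter, Finset.mem_univ, true_and, Fin.le_def]
  omega

theorem domLT_iff {μ ν : Fin N → ℕ} : DomLT μ ν ↔ (∀ k, psum μ k ≤ psum ν k) ∧ μ ≠ ν := by
  rw [DomLT]
  refine and_congr_left fun _ => ⟨fun h0 k => ?_, fun h0 k => ?_⟩
  · have key : ∀ k ≤ N, psum μ k ≤ psum ν k := by
      intro k hk
      rcases k with _ | k
      · simp [psum_zero]
      · have := h0 ⟨k, hk⟩
        rwa [sum_Iic_eq_psum, sum_Iic_eq_psum] at this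
    rcases le_total k N with hk | hk
    · exact key k hk
    · rw [psum_of_ge μ hk, psum_of_ge ν hk]
      exact key N le_rfl
  · rw [sum_Iic_eq_psum, sum_Iic_eq_psum]
    exact h0 _

theorem psum_le_of_mem_support {p : ℕ → ℕ} {g : Poly N} (hg : g ∈ boundedSub N p)
    {κ : Fin N → ℕ} (hκ : expo κ ∈ g.support) {k : ℕ} (hk : k ≤ N) : psum κ k ≤ p k := by
  have := (mem_restrictSupport_iff ℂ).mp hg hκ (Finset.univ.filter (fun i : Fin N => (i : ℕ) < k))
  rwa [card_filter_val_lt hk] at this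

theorem psum_le_psum_of_mem_support {ν : Fin N → ℕ} {g : Poly N} (hg : g ∈ boundedSub N (psum ν))
    {κ : Fin N → ℕ} (hκ : expo κ ∈ g.support) (k : ℕ) : psum κ k ≤ psum ν k := by
  rcases le_total k N with hk | hk
  · exact psum_le_of_mem_support hg hκ hk
  · rw [psum_of_ge κ hk, psum_of_ge ν hk]
    exact psum_le_of_mem_support hg hκ le_rfl

theorem mSymm_mem_boundedSub {μ ν : Fin N → ℕ} (hμ : Antitone μ)
    (hμν : ∀ k, psum μ k ≤ psum ν k) : mSymm μ ∈ boundedSub N (psum ν) := by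
  classical
  rw [mSymm]
  refine Submodule.sum_mem _ fun α hα => ?_
  obtain ⟨w, -, rfl⟩ := Finset.mem_image.mp hα
  rw [prod_X_pow_eq]
  refine (monomial_mem_restrictSupport ℂ).mpr (Or.inl fun I => ?_)
  have := (antitone_sum_le hμ (I.map w.toEmbedding)).trans (hμν _)
  rw [Finset.card_map, Finset.sum_map] at this
  exact this

theorem isExtremal_rev (ν : Fin N → ℕ) : IsExtremal (psum ν) (expo (ν ∘ Fin.rev)) where
  total := by
    rw [psum]
    refine Finset.sum_equiv Fin.revPerm (by simp) (by simp)
  tail m := by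
    rw [psum, Fin.card_Ici]
    refine Finset.sum_equiv Fin.revPerm (fun i => ?_) (by simp)
    simp only [Finset.mem_Ici, Fin.revPerm_apply, Finset.mem_filter, Finset.mem_univ, true_and,
      Fin.val_rev, Fin.le_def]
    omega

/-! ### Leading coefficients of multiples of the Vandermonde polynomial -/

theorem lex_X_sub_X {i j : Fin N} (hij : i < j) :
    MonomialOrder.lex.degree (X i - X j : Poly N) = Finsupp.single i 1 ∧
      MonomialOrder.lex.leadingCoeff (X i - X j : Poly N) = 1 := by
  have hlt : MonomialOrder.lex.toSyn (MonomialOrder.lex.degree (-X j : Poly N)) <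
      MonomialOrder.lex.toSyn (MonomialOrder.lex.degree (X i : Poly N)) := by
    rw [MonomialOrder.degree_neg, MonomialOrder.degree_X, MonomialOrder.degree_X,
      MonomialOrder.lex_lt_iff]
    exact Finsupp.Lex.single_strictAnti hij
  rw [sub_eq_add_neg, MonomialOrder.degree_add_of_lt hlt, MonomialOrder.leadingCoeff_add_of_lt hlt]
  exact ⟨MonomialOrder.degree_X .., MonomialOrder.leadingCoeff_X ..⟩

theorem lex_degree_vand : MonomialOrder.lex.degree (vand N) = expo (staircase N) := by
  rw [vand_eq_prod, MonomialOrder.degree_prod fun p hp =>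
    X_sub_X_ne_zero (by simpa using hp : p.1 < p.2).ne,
    Finset.sum_congr rfl fun p hp => (lex_X_sub_X (by simpa using hp : p.1 < p.2)).1]
  ext k
  rw [Finsupp.finsetSum_apply, Finset.sum_filter, ← Finset.univ_product_univ,
    Finset.sum_product, Finset.sum_eq_single k]
  · have : (Finset.univ.filter fun j => k < j) = Finset.Ioi k := by ext; simp
    simp only [Finsupp.single_eq_same, ← Finset.card_filter, this, Fin.card_Ioi, expo_apply,
      staircase]
  · intro i _ hik
    exact Finset.sum_eq_zero fun j _ => by simp [hik]
  · simp

theorem lex_leadingCoeff_vand : MonomialOrder.lex.leadingCoeff (vand N) = 1 := by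
  rw [vand_eq_prod]
  exact MonomialOrder.Monic.prod fun p hp => (lex_X_sub_X (by simpa using hp : p.1 < p.2)).2

theorem lex_degree_le {ν : Fin N → ℕ} {g : Poly N} (hg : g ∈ boundedSub N (psum ν)) :
    MonomialOrder.lex.toSyn (MonomialOrder.lex.degree g) ≤ MonomialOrder.lex.toSyn (expo ν) := by
  rw [MonomialOrder.degree_le_iff]
  intro α hα
  by_contra hlt
  rw [not_le, MonomialOrder.lex_lt_iff, Finsupp.Lex.lt_iff] at hlt
  obtain ⟨i, h1, h2⟩ := hlt
  have h3 := psum_le_psum_of_mem_support hg (κ := ⇑α) (by rwa [expo_coe]) (i + 1)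
  rw [psum_succ _ i.2, psum_succ _ i.2] at h3
  have h4 : psum (⇑α) i = psum ν i :=
    Finset.sum_congr rfl fun j hj => (h1 j (by simpa using hj)).symm
  have h5 : ν i < α i := h2
  simp only [Fin.eta] at h3
  omega

/-- In the lexicographic order $V$ is monic of degree $\delta$ and $g$ has degree at most $\nu$, so
only one pair of monomials meets at $\nu+\delta$. -/
theorem coeff_vand_mul {ν : Fin N → ℕ} {g : Poly N} (hg : g ∈ boundedSub N (psum ν)) :
    coeff (expo (ν + staircase N)) (vand N * g) = coeff (expo ν) g := by
  have e : expo (ν + staircase N) = expo (staircase N) + expo ν := by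
    ext i; simp [add_comm]
  rw [e, MonomialOrder.coeff_mul_of_add_of_degree_le (m := MonomialOrder.lex)
    (lex_degree_vand (N := N) ▸ le_rfl) (lex_degree_le hg)]
  have := lex_leadingCoeff_vand (N := N)
  rw [MonomialOrder.leadingCoeff, lex_degree_vand] at this
  rw [this, one_mul]

/-! ### The moment functional -/

/-- The moment `∫ x^a x^(γ - 1/2) exp (-x) dx` over the positive half line. -/
def moment (γ : ℝ) (a : ℕ) : ℂ := (Real.Gamma (a + γ + 1 / 2) : ℝ)

theorem moment_succ {γ : ℝ} (hγ : -1 / 2 < γ) (a : ℕ) :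
    moment γ (a + 1) = (a + γ + 1 / 2) * moment γ a := by
  have hpos : (a : ℝ) + γ + 1 / 2 ≠ 0 := by
    have : (0 : ℝ) ≤ a := Nat.cast_nonneg a
    intro e
    linarith
  have := Real.Gamma_add_one hpos
  rw [moment, moment, show ((a + 1 : ℕ) : ℝ) + γ + 1 / 2 = a + γ + 1 / 2 + 1 by push_cast; ring,
    this]
  push_cast
  ring

/-- Integration of a polynomial in the squared variables. -/
def momentFunctional (N : ℕ) (γ : ℝ) : Poly N →ₗ[ℂ] ℂ :=
  (basisMonomials (Fin N) ℂ).constr ℂ fun α => ∏ i, moment γ (α i)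

theorem momentFunctional_monomial (γ : ℝ) (α : Fin N →₀ ℕ) (c : ℂ) :
    momentFunctional N γ (monomial α c) = c * ∏ i, moment γ (α i) := by
  have h1 : momentFunctional N γ (monomial α 1) = ∏ i, moment γ (α i) := by
    have := (basisMonomials (Fin N) ℂ).constr_basis ℂ (fun α => ∏ i, moment γ (α i)) α
    rwa [coe_basisMonomials] at this
  rw [← mul_one c, ← smul_eq_mul, ← smul_monomial, map_smul, h1, smul_eq_mul, smul_eq_mul, mul_one]

theorem momentFunctional_rename (γ : ℝ) (w : Equiv.Perm (Fin N)) (f : Poly N) :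
    momentFunctional N γ (rename w f) = momentFunctional N γ f := by
  induction f using MvPolynomial.induction_on' with
  | monomial u a =>
    rw [rename_monomial, momentFunctional_monomial, momentFunctional_monomial]
    congr 1
    refine (Fintype.prod_equiv w _ _ fun i => ?_).symm
    rw [Finsupp.mapDomain_equiv_apply, Equiv.symm_apply_apply]
  | add p q hp hq => simp only [map_add, hp, hq]

theorem momentFunctional_eq_zero_of_s {γ : ℝ} {j k : Fin N} {f : Poly N} (hf : s j k f = -f) :
    momentFunctional N γ f = 0 := by
  have h1 := momentFunctional_rename γ (Equiv.swap j k) f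
  rw [← s_apply, hf, map_neg] at h1
  have : (2 : ℂ) * momentFunctional N γ f = 0 := by linear_combination -h1
  simpa using this

/-- Integration by parts against $x_j^{\gamma-1/2}e^{-x_j}$, which on monomials is the recurrence of
the Gamma function. -/
theorem momentFunctional_parts {γ : ℝ} (hγ : -1 / 2 < γ) (j : Fin N) (f : Poly N) :
    momentFunctional N γ (X j * pderiv j f + (γ + 1 / 2 : ℂ) • f - X j * f) = 0 := by
  induction f using MvPolynomial.induction_on' with
  | monomial u a =>
    have hX : (X j * monomial u a : Poly N) = monomial (Finsupp.single j 1 + u) a := by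
      rw [X, monomial_mul, one_mul]
    have hprod : ∏ i, moment γ ((Finsupp.single j 1 + u : Fin N →₀ ℕ) i) =
        (u j + γ + 1 / 2) * ∏ i, moment γ (u i) := by
      rw [← Finset.mul_prod_erase _ _ (Finset.mem_univ j),
        ← Finset.mul_prod_erase _ (fun i => moment γ (u i)) (Finset.mem_univ j)]
      rw [Finset.prod_congr rfl fun i hi => show moment γ ((Finsupp.single j 1 + u : Fin N →₀ ℕ) i) =
        moment γ (u i) by simp [Finset.ne_of_mem_erase hi]]
      rw [Finsupp.add_apply, Finsupp.single_eq_same, add_comm 1, moment_succ hγ]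
      ring
    rw [X_mul_pderiv_monomial, hX, map_sub, map_add, map_nsmul, map_smul,
      momentFunctional_monomial, momentFunctional_monomial, hprod, nsmul_eq_mul, smul_eq_mul]
    ring
  | add p q hp hq =>
    have e : X j * pderiv j (p + q) + (γ + 1 / 2 : ℂ) • (p + q) - X j * (p + q) =
        (X j * pderiv j p + (γ + 1 / 2 : ℂ) • p - X j * p) +
        (X j * pderiv j q + (γ + 1 / 2 : ℂ) • q - X j * q) := by
      rw [map_add]
      simp only [smul_eq_C_mul]
      ring
    rw [e, map_add, hp, hq, add_zero]

/-! ### The bilinear form and self-adjointness -/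

/-- The weight polynomial. -/
def weight (N β : ℕ) : Poly N := vand N ^ (2 * β)

/-- The scalar product in the squared variables. -/
def form (β : ℕ) (γ : ℝ) (f g : Poly N) : ℂ := momentFunctional N γ (weight N β * (f * g))

theorem rename_weight (β : ℕ) (w : Equiv.Perm (Fin N)) :
    rename w (weight N β) = weight N β := by
  rw [weight, map_pow, isAntisymmetric_vand, smul_pow, pow_mul]
  have : (((Equiv.Perm.sign w : ℤ) : ℂ)) ^ 2 = 1 := by
    rcases Int.units_eq_one_or (Equiv.Perm.sign w) with e | e <;> simp [e]
  rw [this, one_pow, one_smul]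

theorem form_rename (β : ℕ) (γ : ℝ) (w : Equiv.Perm (Fin N)) (f g : Poly N) :
    form β γ (rename w f) (rename w g) = form β γ f g := by
  rw [form, ← rename_weight β w, ← map_mul, ← map_mul, momentFunctional_rename, form]

theorem form_comm (β : ℕ) (γ : ℝ) (f g : Poly N) : form β γ f g = form β γ g f := by
  rw [form, form, mul_comm f]

/-- `form` as a bilinear map. -/
def formHom (N β : ℕ) (γ : ℝ) : Poly N →ₗ[ℂ] Poly N →ₗ[ℂ] ℂ :=
  LinearMap.mk₂ ℂ (form β γ) (fun f f' g => by simp only [form, add_mul, mul_add, map_add])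
    (fun c f g => by simp only [form, smul_mul_assoc, mul_smul_comm, map_smul])
    (fun f g g' => by simp only [form, mul_add, map_add])
    (fun c f g => by simp only [form, mul_smul_comm, map_smul])

theorem formHom_apply (β : ℕ) (γ : ℝ) (f g : Poly N) : formHom N β γ f g = form β γ f g := rfl

/-- The quotient of the Vandermonde polynomial by `X_j - X_k`. -/
def vandQuot (j k : Fin N) : Poly N :=
  if j < k then shiftPolyErase 0 j k else -shiftPolyErase 0 k j

theorem mul_vandQuot {j k : Fin N} (hjk : j ≠ k) : (X j - X k) * vandQuot j k = vand N := by
  rw [vandQuot, vand]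
  split_ifs with hlt
  · rw [shiftPoly_eq 0 hlt]; simp
  · rw [shiftPoly_eq 0 (lt_of_le_of_ne (not_lt.mp hlt) hjk.symm)]; simp; ring

theorem pderiv_prod {ι : Type*} [DecidableEq ι] (j : Fin N) (P : Finset ι) (l : ι → Poly N) :
    pderiv j (∏ p ∈ P, l p) = ∑ p ∈ P, (∏ r ∈ P.erase p, l r) * pderiv j (l p) := by
  induction P using Finset.induction with
  | empty => simp
  | insert a P ha ih =>
    rw [Finset.prod_insert ha, Derivation.leibniz, ih, Finset.sum_insert ha,
      Finset.erase_insert ha, smul_eq_mul, smul_eq_mul, Finset.mul_sum, add_comm]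
    congr 1
    refine Finset.sum_congr rfl fun p hp => ?_
    have hap : a ≠ p := by rintro rfl; exact ha hp
    rw [Finset.erase_insert_of_ne hap, Finset.prod_insert (fun h => ha (Finset.mem_of_mem_erase h)),
      mul_assoc]

theorem pderiv_vand (j : Fin N) : pderiv j (vand N) =
    ∑ k ∈ Finset.univ.filter (fun k => k ≠ j), vandQuot j k := by
  have hl : ∀ p : Fin N × Fin N, pderiv j (C 0 + X p.1 - X p.2 : Poly N) =
      (if j = p.1 then 1 else 0) - (if j = p.2 then 1 else 0) := by
    intro p
    simp [pderiv_X, Pi.single_apply, eq_comm]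
  rw [vand, shiftPoly, pderiv_prod]
  simp only [hl]
  have h1 : ∀ p : Fin N × Fin N, (∏ r ∈ (Finset.univ.filter
      (fun p : Fin N × Fin N => p.1 < p.2)).erase p, (C 0 + X r.1 - X r.2 : Poly N)) =
      shiftPolyErase 0 p.1 p.2 := fun p => rfl
  simp only [h1]
  rw [Finset.sum_filter, ← Finset.univ_product_univ, Finset.sum_product]
  simp only [mul_sub, mul_ite, mul_one, mul_zero]
  have h2 : ∀ a b : Fin N, (if a < b then (if j = a then shiftPolyErase 0 a b else 0) -
      (if j = b then shiftPolyErase 0 a b else 0) else (0 : Poly N)) =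
      (if j = a then (if a < b then shiftPolyErase 0 a b else 0) else 0)
      - (if j = b then (if a < b then shiftPolyErase 0 a b else 0) else 0) := by
    intro a b
    split_ifs <;> simp
  simp only [h2, Finset.sum_sub_distrib]
  rw [Finset.sum_comm]
  simp only [Finset.sum_ite_eq, Finset.mem_univ, if_true]
  rw [← Finset.sum_sub_distrib, Finset.sum_filter]
  refine Finset.sum_congr rfl fun k _ => ?_
  rw [vandQuot]
  rcases lt_trichotomy j k with h3 | rfl | h3
  · simp [h3, h3.not_gt, h3.ne']
  · simp
  · simp [h3, h3.not_gt, h3.ne]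

theorem exists_pderiv_weight (β : ℕ) (j : Fin N) : ∃ E : Fin N → Poly N,
    (∀ k, k ≠ j → (X j - X k) * E k = C (β : ℂ) * weight N β) ∧
    pderiv j (weight N β) = 2 * ∑ k ∈ Finset.univ.filter (fun k => k ≠ j), E k := by
  -- $E_k$ stands for $\beta W/(X_j-X_k)$. At $\beta=0$ the exponent $2\beta-1$ is truncated to $0$,
  -- but the factor $\beta$ vanishes.
  refine ⟨fun k => C (β : ℂ) * (vandQuot j k * vand N ^ (2 * β - 1)), fun k hk => ?_, ?_⟩
  · rcases β with _ | b
    · simp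
    · rw [weight, show 2 * (b + 1) = 2 * b + 1 + 1 by ring, Nat.add_sub_cancel, pow_succ]
      linear_combination C ((b + 1 : ℕ) : ℂ) * vand N ^ (2 * b + 1) * mul_vandQuot hk.symm
  · rw [weight, Derivation.leibniz_pow, pderiv_vand, ← Finset.mul_sum, ← Finset.sum_mul]
    simp only [nsmul_eq_mul, smul_eq_mul]
    simp
    ring

theorem s_weightQuot {β : ℕ} {j k : Fin N} (hjk : j ≠ k) {E : Poly N}
    (hE : (X j - X k) * E = C (β : ℂ) * weight N β) : s j k E = -E := by
  apply mul_left_cancel₀ (X_sub_X_ne_zero hjk)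
  have h1 := congrArg (s j k) hE
  have h2 : s j k (C (β : ℂ) * weight N β) = C (β : ℂ) * weight N β := by
    rw [s_mul, s_apply, s_apply, rename_weight, rename_C]
  rw [h2, s_mul, map_sub, s_X, s_X, Equiv.swap_apply_left, Equiv.swap_apply_right] at h1
  linear_combination -h1 + hE

/-- Integration by parts: the derivative of the weight supplies $2\sum_kE_k$, which the divided
differences in both arguments absorb up to terms antisymmetric under $s_{jk}$. -/
theorem form_X_mul_dunklA {γ : ℝ} (hγ : -1 / 2 < γ) (β : ℕ) (j : Fin N) (q g : Poly N) :
    form β γ (X j * q - dunklA β j (X j * q) - ((γ : ℂ) - 1 / 2) • q) g =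
      form β γ (X j * q) (dunklA β j g) := by
  obtain ⟨E, hE, hW⟩ := exists_pderiv_weight β j
  set F : Poly N := weight N β * (q * g) with hF
  -- $E_k$ is antisymmetric and the bracket symmetric under $s_{jk}$, while the functional is
  -- invariant.
  have hz : ∀ k ∈ Finset.univ.filter (fun k => k ≠ j),
      momentFunctional N γ (E k * (X j * q * s j k g + X k * s j k q * g)) = 0 := by
    intro k hk
    have hk : k ≠ j := by simpa using hk
    refine momentFunctional_eq_zero_of_s (j := j) (k := k) ?_
    rw [s_mul, map_add, s_mul, s_mul, s_mul, s_mul, s_X, s_X, s_s, s_s,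
      s_weightQuot hk.symm (hE k hk), Equiv.swap_apply_left, Equiv.swap_apply_right]
    ring
  have hk : ∀ k ∈ Finset.univ.filter (fun k => k ≠ j),
      C (β : ℂ) * weight N β * (X j * q * diffMinus j k g + diffMinus j k (X j * q) * g) =
        2 * E k * (X j * q * g) - E k * (X j * q * s j k g + X k * s j k q * g) := by
    intro k hk
    have hk : k ≠ j := by simpa using hk
    have h2 := mul_diffMinus hk.symm (X j * q)
    rw [s_mul, s_X, Equiv.swap_apply_left] at h2
    rw [← hE k hk]
    linear_combination E k * X j * q * mul_diffMinus hk.symm g + E k * g * h2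
  have hsum := Finset.sum_congr rfl hk
  rw [Finset.sum_sub_distrib, ← Finset.mul_sum, ← Finset.sum_mul, ← Finset.mul_sum,
    Finset.sum_add_distrib, ← Finset.mul_sum, ← Finset.sum_mul, ← hW] at hsum
  have key : weight N β * (X j * q * dunklA β j g) - weight N β *
      ((X j * q - dunklA β j (X j * q) - ((γ : ℂ) - 1 / 2) • q) * g) =
      (X j * pderiv j F + (γ + 1 / 2 : ℂ) • F - X j * F)
      - ∑ k ∈ Finset.univ.filter (fun k => k ≠ j),
        E k * (X j * q * s j k g + X k * s j k q * g) := by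
    have hC : (C (1 / 2 : ℂ) : Poly N) + C (1 / 2) = 1 := by rw [← C_add]; norm_num
    rw [hF, dunklA_apply, dunklA_apply]
    simp only [Derivation.leibniz, pderiv_X_self, smul_eq_mul]
    simp only [smul_eq_C_mul, map_add, map_sub]
    linear_combination hsum - weight N β * q * g * hC
  have := congrArg (momentFunctional N γ) key
  rw [map_sub, map_sub, momentFunctional_parts hγ, map_sum, Finset.sum_eq_zero hz, sub_zero,
    sub_eq_zero] at this
  rw [form, form]
  exact this.symm

/-- With $q=T_jf$ the preceding lemma turns the left side into the pairing of $x_jT_jf$ with $T_jg$,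
which is symmetric in $f$ and $g$. -/
theorem form_quadA {γ : ℝ} (hγ : -1 / 2 < γ) (β : ℕ) (j : Fin N) (f g : Poly N) :
    form β γ (quadA β γ j f) g = form β γ f (quadA β γ j g) := by
  rw [form_comm β γ f, quadA_apply, quadA_apply, eulerA_apply, eulerA_apply,
    form_X_mul_dunklA hγ, form_X_mul_dunklA hγ, form, form]
  refine congrArg _ ?_
  ring

theorem form_opA {γ : ℝ} (hγ : -1 / 2 < γ) (β : ℕ) (j : Fin N) (f g : Poly N) :
    form β γ (opA β γ j f) g = form β γ f (opA β γ j g) := by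
  have hs : ∀ k, form β γ (s j k f) g = form β γ f (s j k g) := fun k => by
    conv_lhs => rw [← s_s j k g]
    exact form_rename β γ _ f (s j k g)
  rw [opA_apply, opA_apply, ← formHom_apply, ← formHom_apply]
  simp only [map_add, map_smul, map_sum, LinearMap.add_apply, LinearMap.smul_apply,
    LinearMap.sum_apply, formHom_apply, form_quadA hγ, hs]

theorem form_evalOp {γ : ℝ} (hγ : -1 / 2 < γ) (β : ℕ) (p f g : Poly N) :
    form β γ (evalOp β γ p f) g = form β γ f (evalOp β γ p g) := by
  induction p using MvPolynomial.induction_on generalizing f g with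
  | C a =>
    rw [evalOp_C, evalOp_C, ← formHom_apply, ← formHom_apply, map_smul, map_smul]
    rfl
  | add p q hp hq =>
    simp only [map_add, LinearMap.add_apply, ← formHom_apply] at hp hq ⊢
    rw [hp, hq]
  | mul_X p k ih =>
    rw [evalOp_X_mul', form_opA hγ, ih, map_mul, evalOp_X]
    rfl

/-! ### The scalar product as an integral -/

/-- The one-dimensional weight `|x|^(2γ) exp (-x²)`. -/
def weightFun (γ : ℝ) (x : ℝ) : ℝ := (|x| ^ γ * Real.exp (-x ^ 2 / 2)) ^ 2

theorem weightFun_pos {γ x : ℝ} (hx : x ≠ 0) : 0 < weightFun γ x := by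
  have := abs_pos.mpr hx
  unfold weightFun
  positivity

theorem integral_pow_mul_weightFun {γ : ℝ} (hγ : -1 / 2 < γ) (a : ℕ) :
    ∫ x : ℝ, (x ^ 2) ^ a * weightFun γ x = Real.Gamma (a + γ + 1 / 2) := by
  have e1 : ∀ x : ℝ, (x ^ 2) ^ a * weightFun γ x =
      (fun t : ℝ => (t ^ 2) ^ a * (t ^ γ * Real.exp (-t ^ 2 / 2)) ^ 2) |x| := by
    intro x
    simp only [weightFun, sq_abs]
  rw [integral_congr_ae (Filter.Eventually.of_forall e1), integral_comp_abs
    (f := fun t : ℝ => (t ^ 2) ^ a * (t ^ γ * Real.exp (-t ^ 2 / 2)) ^ 2)]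
  have e2 : ∀ t ∈ Set.Ioi (0 : ℝ), (t ^ 2) ^ a * (t ^ γ * Real.exp (-t ^ 2 / 2)) ^ 2 =
      t ^ (2 * a + 2 * γ) * Real.exp (-t ^ (2 : ℝ)) := by
    intro t ht
    have ht : 0 < t := ht
    have h1 : (t ^ γ) ^ 2 = t ^ (2 * γ) := by
      rw [← Real.rpow_natCast, ← Real.rpow_mul ht.le]
      congr 1
      push_cast
      ring
    have h2 : (t ^ 2) ^ a = t ^ (2 * (a : ℝ)) := by
      rw [← pow_mul, ← Real.rpow_natCast]
      push_cast
      rfl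
    have h3 : Real.exp (-t ^ 2 / 2) ^ 2 = Real.exp (-t ^ (2 : ℝ)) := by
      rw [← Real.exp_nat_mul, Real.rpow_two]
      congr 1
      push_cast
      ring
    rw [mul_pow, h1, h2, h3, Real.rpow_add ht]
    ring
  have ha : (0 : ℝ) ≤ a := Nat.cast_nonneg a
  rw [setIntegral_congr_fun measurableSet_Ioi e2,
    integral_rpow_mul_exp_neg_rpow (by norm_num) (by linarith)]
  rw [show (2 * (a : ℝ) + 2 * γ + 1) / 2 = a + γ + 1 / 2 by ring]
  ring

theorem integrable_pow_mul_weightFun {γ : ℝ} (hγ : -1 / 2 < γ) (a : ℕ) :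
    Integrable fun x : ℝ => (x ^ 2) ^ a * weightFun γ x := by
  have ha : (0 : ℝ) ≤ a := Nat.cast_nonneg a
  -- A non-integrable function has integral $0$ by convention, but the integral was found to be a
  -- positive value of Gamma.
  by_contra hn
  have := integral_undef hn
  rw [integral_pow_mul_weightFun hγ] at this
  exact (Real.Gamma_pos_of_pos (by linarith : (0 : ℝ) < a + γ + 1 / 2)).ne' this

/-- Evaluation at the squares of a real point. -/
def evalSq (z : Fin N → ℝ) : Poly N →+* ℂ := eval fun i => ((z i ^ 2 : ℝ) : ℂ)

theorem evalSq_eq (z : Fin N → ℝ) (f : Poly N) :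
    eval (fun i => (z i : ℂ)) (expand 2 f) = evalSq z f := by
  rw [evalSq, eval_expand]
  congr 2
  ext i
  simp

theorem integrable_and_integral {γ : ℝ} (hγ : -1 / 2 < γ) (f : Poly N) :
    Integrable (fun z : Fin N → ℝ => evalSq z f * ((∏ i, weightFun γ (z i) : ℝ) : ℂ)) ∧
    ∫ z : Fin N → ℝ, evalSq z f * ((∏ i, weightFun γ (z i) : ℝ) : ℂ) =
      momentFunctional N γ f := by
  induction f using MvPolynomial.induction_on' with
  | monomial u a =>
    have e : ∀ z : Fin N → ℝ, evalSq z (monomial u a) * ((∏ i, weightFun γ (z i) : ℝ) : ℂ) =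
        a * ∏ i, (((z i ^ 2) ^ u i * weightFun γ (z i) : ℝ) : ℂ) := by
      intro z
      rw [evalSq, eval_monomial, Finsupp.prod_fintype _ _ (by simp)]
      push_cast
      rw [Finset.prod_mul_distrib]
      ring
    simp only [e]
    constructor
    · exact (Integrable.fintype_prod fun i =>
        (integrable_pow_mul_weightFun hγ (u i)).ofReal).const_mul a
    · rw [integral_const_mul, momentFunctional_monomial]
      congr 1
      rw [integral_fintype_prod_volume_eq_prod
        (fun i (x : ℝ) => (((x ^ 2) ^ u i * weightFun γ x : ℝ) : ℂ))]
      refine Finset.prod_congr rfl fun i _ => ?_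
      rw [integral_complex_ofReal, integral_pow_mul_weightFun hγ, moment]
  | add p q hp hq =>
    simp only [map_add, add_mul]
    exact ⟨hp.1.add hq.1, by rw [integral_add hp.1 hq.1, hp.2, hq.2]⟩

theorem groundState_sq (β : ℕ) (γ : ℝ) (z : Fin N → ℝ) : ((groundState β γ z ^ 2 : ℝ) : ℂ) =
    evalSq z (weight N β) * ((∏ i, weightFun γ (z i) : ℝ) : ℂ) := by
  have e1 : groundState β γ z ^ 2 =
      (∏ p ∈ Finset.univ.filter (fun p : Fin N × Fin N => p.1 < p.2),
        (z p.1 ^ 2 - z p.2 ^ 2)) ^ (2 * β) * ∏ i, weightFun γ (z i) := by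
    rw [groundState, mul_pow, ← Finset.prod_pow, ← Finset.prod_pow, ← Finset.prod_pow]
    congr 1
    refine Finset.prod_congr rfl fun p _ => ?_
    rw [← pow_mul, mul_comm β 2, pow_mul, sq_abs, ← pow_mul]
  rw [e1, weight, vand_eq_prod, evalSq]
  simp

theorem scalarProd_expand {γ : ℝ} (hγ : -1 / 2 < γ) (β : ℕ) (f g : Poly N) :
    scalarProd β γ (expand 2 f) (expand 2 g) = form β γ f g := by
  rw [form, ← (integrable_and_integral hγ _).2, scalarProd]
  congr 1
  ext z
  rw [evalSq_eq, evalSq_eq, groundState_sq, map_mul, map_mul]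
  ring

/-- Complex conjugation of the coefficients. -/
def conjPoly : Poly N →+* Poly N := MvPolynomial.map (starRingEnd ℂ)

theorem evalSq_conjPoly (z : Fin N → ℝ) (f : Poly N) :
    evalSq z (conjPoly f) = starRingEnd ℂ (evalSq z f) := by
  have e : (evalSq z).comp conjPoly = (starRingEnd ℂ).comp (evalSq z) := by
    refine ringHom_ext (fun c => ?_) fun i => ?_
    · simp [evalSq, conjPoly]
    · simp [evalSq, conjPoly]
  exact DFunLike.congr_fun e f

theorem eq_zero_of_evalSq {f : Poly N} (hf : ∀ z : Fin N → ℝ, (∏ i, z i ≠ 0) → evalSq z f = 0) :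
    f = 0 := by
  -- The factor $\prod X_i$ removes the restriction to points off the coordinate hyperplanes.
  have h1 : expand 2 f * ∏ i, X i = 0 := by
    refine funext_set (fun _ => Set.range ((↑) : ℝ → ℂ))
      (fun _ => Set.infinite_range_of_injective Complex.ofReal_injective) fun x hx => ?_
    choose z hz using fun i => hx i (Set.mem_univ i)
    obtain rfl : x = fun i => (z i : ℂ) := funext fun i => (hz i).symm
    rw [map_mul, evalSq_eq, map_zero]
    by_cases h0 : ∏ i, z i = 0
    · have : (∏ i, (z i : ℂ)) = 0 := by exact_mod_cast h0
      simp [map_prod, this]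
    · rw [hf z h0, zero_mul]
  rcases mul_eq_zero.mp h1 with h2 | h2
  · exact expand_injective two_pos (h2.trans (map_zero _).symm)
  · exact absurd h2 (Finset.prod_ne_zero_iff.mpr fun i _ => X_ne_zero i)

/-- The form is bilinear, so positivity appears only after conjugating one argument: the integrand
becomes $|f|^2$ times the weight. -/
theorem eq_zero_of_form_conj {γ : ℝ} (hγ : -1 / 2 < γ) (β : ℕ) {f : Poly N}
    (hf : form β γ f (conjPoly f) = 0) : f = 0 := by
  set F : (Fin N → ℝ) → ℝ := fun z => ‖evalSq z f‖ ^ 2 * groundState β γ z ^ 2 with hF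
  have e : ∀ z : Fin N → ℝ, evalSq z (weight N β * (f * conjPoly f)) *
      ((∏ i, weightFun γ (z i) : ℝ) : ℂ) = (F z : ℂ) := by
    intro z
    rw [hF, Complex.ofReal_mul, groundState_sq, map_mul, map_mul, evalSq_conjPoly,
      Complex.mul_conj, Complex.normSq_eq_norm_sq]
    ring
  obtain ⟨h1, h2⟩ := integrable_and_integral hγ (weight N β * (f * conjPoly f))
  simp only [e] at h1 h2
  rw [form] at hf
  rw [hf, integral_complex_ofReal] at h2
  have h1' : Integrable F := by simpa using h1.re
  have h3 : F =ᵐ[volume] 0 :=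
    (integral_eq_zero_iff_of_nonneg (fun z => by positivity) h1').mp (by exact_mod_cast h2)
  -- The weight may be singular where some $z_i=0$; the continuous function $fV\prod z_i$ replaces
  -- it, since for continuous functions vanishing almost everywhere means vanishing.
  have h4 : (fun z : Fin N → ℝ => evalSq z (f * vand N) * ((∏ i, z i : ℝ) : ℂ)) =ᵐ[volume]
      fun _ => 0 := by
    filter_upwards [h3] with z hz
    by_contra hne
    rw [map_mul] at hne
    have hp : ∏ i, z i ≠ 0 := fun h0 => hne (by rw [h0]; simp)
    have hw : (∏ i, weightFun γ (z i)) ≠ 0 := Finset.prod_ne_zero_iff.mpr fun i hi =>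
      (weightFun_pos (Finset.prod_ne_zero_iff.mp hp i hi)).ne'
    have hfz : evalSq z f ≠ 0 := fun h0 => hne (by rw [h0]; simp)
    have hvz : evalSq z (vand N) ≠ 0 := fun h0 => hne (by rw [h0]; simp)
    have hz' : F z = 0 := hz
    have hz'' : ((groundState β γ z ^ 2 : ℝ) : ℂ) = 0 := by
      rw [hF] at hz'
      rw [(mul_eq_zero.mp hz').resolve_left (by simpa using hfz)]
      simp
    rw [groundState_sq, weight, map_pow, mul_eq_zero] at hz''
    rcases hz'' with h5 | h5
    · exact pow_ne_zero _ hvz h5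
    · exact hw (by exact_mod_cast h5)
  have hcont : Continuous fun z : Fin N → ℝ =>
      evalSq z (f * vand N) * ((∏ i, z i : ℝ) : ℂ) := by
    refine Continuous.mul ?_ (by fun_prop)
    exact (MvPolynomial.continuous_eval (f * vand N)).comp (by fun_prop)
  have h6 := (Continuous.ae_eq_iff_eq volume hcont continuous_const).mp h4
  have h7 : f * vand N = 0 := eq_zero_of_evalSq fun z hz => by
    have := congrFun h6 z
    exact (mul_eq_zero.mp this).resolve_right (by exact_mod_cast hz)
  exact (mul_eq_zero.mp h7).resolve_right vand_ne_zero

/-! ### Existence and uniqueness of the Laguerre polynomials -/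

/-- The span of the `m_κ` with `κ < ν`. -/
def mSpan (ν : Fin N → ℕ) : Submodule ℂ (Poly N) :=
  Submodule.span ℂ {q : Poly N | ∃ κ : Fin N → ℕ, Antitone κ ∧ DomLT κ ν ∧ q = mSymm κ}

/-- The Laguerre polynomials in the squared variables. -/
structure IsLaguerreSq (β : ℕ) (γ : ℝ) (ν : Fin N → ℕ) (f : Poly N) : Prop where
  triangular : f - mSymm ν ∈ mSpan ν
  orthogonal : ∀ g ∈ mSpan ν, form β γ f g = 0

theorem form_eq_zero_of_mSpan {β : ℕ} {γ : ℝ} {ν : Fin N → ℕ} {f : Poly N}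
    (hf : ∀ κ, Antitone κ → DomLT κ ν → form β γ f (mSymm κ) = 0) {g : Poly N}
    (hg : g ∈ mSpan ν) : form β γ f g = 0 := by
  have : mSpan ν ≤ LinearMap.ker (formHom N β γ f) := by
    refine Submodule.span_le.mpr ?_
    rintro q ⟨κ, h1, h2, rfl⟩
    exact hf κ h1 h2
  exact this hg

theorem isLaguerre_iff {γ : ℝ} (hγ : -1 / 2 < γ) (β : ℕ) (ν : Fin N → ℕ) (P : Poly N) :
    IsLaguerre β γ ν P ↔ ∃ f, P = expand 2 f ∧ IsLaguerreSq β γ ν f := by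
  have hspan : Submodule.span ℂ {p : Poly N | ∃ μ : Fin N → ℕ, Antitone μ ∧ DomLT μ ν ∧ p = mSq μ} =
      (mSpan ν).map (expand 2 : Poly N →ₐ[ℂ] Poly N).toLinearMap := by
    rw [mSpan, Submodule.map_span]
    congr 1
    ext p
    constructor
    · rintro ⟨μ, h1, h2, rfl⟩
      exact ⟨_, ⟨μ, h1, h2, rfl⟩, rfl⟩
    · rintro ⟨_, ⟨μ, h1, h2, rfl⟩, rfl⟩
      exact ⟨μ, h1, h2, rfl⟩
  constructor
  · rintro ⟨h1, h2⟩
    rw [hspan] at h1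
    obtain ⟨d, hd, hde⟩ := h1
    have hP : P = expand 2 (d + mSymm ν) := by
      rw [map_add, ← mSq]
      exact (sub_eq_iff_eq_add.mp hde.symm)
    refine ⟨d + mSymm ν, hP, by rwa [add_sub_cancel_right], fun g hg => ?_⟩
    refine form_eq_zero_of_mSpan (fun κ hκ hκν => ?_) hg
    rw [← scalarProd_expand hγ, ← hP]
    exact h2 κ hκ hκν
  · rintro ⟨f, rfl, h1, h2⟩
    refine ⟨?_, fun μ hμ hμν => ?_⟩
    · rw [hspan, mSq, ← map_sub]
      exact ⟨_, h1, rfl⟩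
    · rw [mSq, scalarProd_expand hγ]
      exact h2 _ (Submodule.subset_span ⟨μ, hμ, hμν, rfl⟩)

theorem conjPoly_mem_mSpan {ν : Fin N → ℕ} {f : Poly N} (hf : f ∈ mSpan ν) :
    conjPoly f ∈ mSpan ν := by
  induction hf using Submodule.span_induction with
  | mem q hq =>
    obtain ⟨κ, h1, h2, rfl⟩ := hq
    have : conjPoly (mSymm κ) = mSymm κ := by simp [conjPoly, mSymm]
    rw [this]
    exact Submodule.subset_span ⟨κ, h1, h2, rfl⟩
  | zero => rw [map_zero]; exact Submodule.zero_mem _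
  | add p q _ _ hp hq => rw [map_add]; exact Submodule.add_mem _ hp hq
  | smul c p _ hp =>
    rw [smul_eq_C_mul, map_mul, conjPoly, map_C, ← smul_eq_C_mul]
    exact Submodule.smul_mem _ _ hp

theorem eq_zero_of_mem_mSpan {γ : ℝ} (hγ : -1 / 2 < γ) {β : ℕ} {ν : Fin N → ℕ} {f : Poly N}
    (hf : f ∈ mSpan ν) (h0 : ∀ g ∈ mSpan ν, form β γ f g = 0) : f = 0 :=
  eq_zero_of_form_conj hγ β (h0 _ (conjPoly_mem_mSpan hf))

instance finiteDimensional_mSpan (ν : Fin N → ℕ) : FiniteDimensional ℂ (mSpan ν) := by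
  refine FiniteDimensional.span_of_finite ℂ ?_
  refine Set.Finite.subset ((Set.finite_Iic fun i : Fin N => psum ν (i + 1)).image mSymm) ?_
  rintro q ⟨κ, -, h2, rfl⟩
  refine ⟨κ, fun i => ?_, rfl⟩
  have := (domLT_iff.mp h2).1 (i + 1)
  rw [psum_succ κ i.2] at this
  exact le_trans (Nat.le_add_left _ _) this

/-- The form is nondegenerate on the finite-dimensional `mSpan ν`, so a correction of $m_\nu$ from
this space can cancel all its pairings there. -/
theorem exists_isLaguerreSq {γ : ℝ} (hγ : -1 / 2 < γ) (β : ℕ) (ν : Fin N → ℕ) :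
    ∃ f, IsLaguerreSq β γ ν f := by
  let φ : mSpan ν →ₗ[ℂ] Module.Dual ℂ (mSpan ν) :=
    (formHom N β γ).compl₁₂ (mSpan ν).subtype (mSpan ν).subtype
  have hφ : ∀ d u : mSpan ν, φ d u = form β γ (d : Poly N) (u : Poly N) := fun d u => by
    simp only [φ, LinearMap.compl₁₂_apply, Submodule.subtype_apply, formHom_apply]
  have hinj : Function.Injective φ := by
    rw [injective_iff_map_eq_zero]
    intro d hd
    have h1 : (d : Poly N) = 0 := eq_zero_of_mem_mSpan (β := β) hγ d.2 fun g hg => by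
      have := hφ d ⟨g, hg⟩
      rw [hd, LinearMap.zero_apply] at this
      exact this.symm
    exact (Submodule.coe_eq_zero).mp h1
  have hsurj : Function.Surjective φ :=
    (LinearMap.injective_iff_surjective_of_finrank_eq_finrank
      Subspace.dual_finrank_eq.symm).mp hinj
  obtain ⟨d, hd⟩ := hsurj (-((formHom N β γ (mSymm ν)).comp (mSpan ν).subtype))
  refine ⟨mSymm ν + d, by rw [add_sub_cancel_left]; exact d.2, fun g hg => ?_⟩
  have h1 : form β γ d g = -form β γ (mSymm ν) g := by
    rw [← hφ d ⟨g, hg⟩, hd, LinearMap.neg_apply, LinearMap.comp_apply, Submodule.subtype_apply,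
      formHom_apply]
  rw [← formHom_apply, map_add, LinearMap.add_apply, formHom_apply, formHom_apply, h1,
    add_neg_cancel]

/-- The difference lies in `mSpan ν` and is orthogonal to it. The free factor $c$ lets the lemma
deliver the shift relations as well as uniqueness. -/
theorem IsLaguerreSq.unique {γ : ℝ} (hγ : -1 / 2 < γ) {β : ℕ} {ν : Fin N → ℕ} {f g : Poly N}
    {c : ℂ} (hg : IsLaguerreSq β γ ν g) (hf : f - c • mSymm ν ∈ mSpan ν)
    (h0 : ∀ u ∈ mSpan ν, form β γ f u = 0) : f = c • g := by
  rw [← sub_eq_zero]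
  refine eq_zero_of_mem_mSpan (β := β) (ν := ν) hγ ?_ fun u hu => ?_
  · have : f - c • g = (f - c • mSymm ν) - c • (g - mSymm ν) := by
      rw [smul_sub]; abel
    rw [this]
    exact Submodule.sub_mem _ hf (Submodule.smul_mem _ _ hg.triangular)
  · have h1 := h0 u hu
    have h2 := hg.orthogonal u hu
    rw [← formHom_apply] at h1 h2 ⊢
    rw [map_sub, map_smul, LinearMap.sub_apply, LinearMap.smul_apply, h1, h2, smul_zero, sub_zero]

theorem existsUnique_isLaguerre {γ : ℝ} (hγ : -1 / 2 < γ) (β : ℕ) (ν : Fin N → ℕ) :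
    ∃! P : Poly N, IsLaguerre β γ ν P := by
  obtain ⟨f, hf⟩ := exists_isLaguerreSq hγ β ν
  refine ⟨expand 2 f, (isLaguerre_iff hγ β ν _).mpr ⟨f, rfl, hf⟩, fun P hP => ?_⟩
  obtain ⟨g, rfl, hg⟩ := (isLaguerre_iff hγ β ν _).mp hP
  have := hf.unique hγ (c := 1) (by rw [one_smul]; exact hg.triangular) hg.orthogonal
  rw [this, one_smul]

/-! ### Properties of elements of `mSpan` -/

theorem mem_mSpan {ν : Fin N → ℕ} {g : Poly N} (hg : g.IsSymmetric)
    (hκ : ∀ κ, Antitone κ → expo κ ∈ g.support → DomLT κ ν) : g ∈ mSpan ν := by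
  refine Submodule.span_mono ?_ hg.mem_span_mSymm
  rintro q ⟨κ, h1, h2, rfl⟩
  exact ⟨κ, h1, hκ κ h1 h2, rfl⟩

theorem mSpan_le {ν : Fin N → ℕ} {f : Poly N} (hf : f ∈ mSpan ν) :
    f.IsSymmetric ∧ f ∈ boundedSub N (psum ν) ∧ (Antitone ν → coeff (expo ν) f = 0) := by
  induction hf using Submodule.span_induction with
  | mem q hq =>
    obtain ⟨κ, h1, h2, rfl⟩ := hq
    refine ⟨isSymmetric_mSymm κ, mSymm_mem_boundedSub h1 (domLT_iff.mp h2).1, fun hν => ?_⟩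
    rw [coeff_mSymm, if_neg]
    rintro ⟨w, hw⟩
    exact h2.2 (eq_of_antitone_comp h1 hν hw)
  | zero => exact ⟨MvPolynomial.IsSymmetric.zero, Submodule.zero_mem _, fun _ => coeff_zero _⟩
  | add p q _ _ hp hq =>
    exact ⟨hp.1.add hq.1, Submodule.add_mem _ hp.2.1 hq.2.1, fun hν => by
      rw [coeff_add, hp.2.2 hν, hq.2.2 hν, add_zero]⟩
  | smul c p _ hp =>
    exact ⟨hp.1.smul c, Submodule.smul_mem _ _ hp.2.1, fun hν => by
      rw [coeff_smul, hp.2.2 hν, smul_zero]⟩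

theorem IsLaguerreSq.isSymmetric {β : ℕ} {γ : ℝ} {ν : Fin N → ℕ} {f : Poly N}
    (hf : IsLaguerreSq β γ ν f) : f.IsSymmetric := by
  have := (mSpan_le hf.triangular).1.add (isSymmetric_mSymm ν)
  rwa [sub_add_cancel] at this

theorem IsLaguerreSq.mem_boundedSub {β : ℕ} {γ : ℝ} {ν : Fin N → ℕ} {f : Poly N}
    (hf : IsLaguerreSq β γ ν f) (hν : Antitone ν) : f ∈ boundedSub N (psum ν) := by
  have := Submodule.add_mem _ (mSpan_le hf.triangular).2.1
    (mSymm_mem_boundedSub hν fun k => le_refl (psum ν k))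
  rwa [sub_add_cancel] at this

theorem coeff_mSymm_self (ν : Fin N → ℕ) : coeff (expo ν) (mSymm ν) = 1 := by
  rw [coeff_mSymm, if_pos ⟨1, by simp⟩]

theorem IsLaguerreSq.coeff_eq_one {β : ℕ} {γ : ℝ} {ν : Fin N → ℕ} {f : Poly N}
    (hf : IsLaguerreSq β γ ν f) (hν : Antitone ν) : coeff (expo ν) f = 1 := by
  have := (mSpan_le hf.triangular).2.2 hν
  rw [coeff_sub, coeff_mSymm_self, sub_eq_zero] at this
  exact this

theorem sub_smul_mSymm_mem_mSpan {ν : Fin N → ℕ} (hν : Antitone ν) {f : Poly N}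
    (hf : f.IsSymmetric) (hb : f ∈ boundedSub N (psum ν)) :
    f - coeff (expo ν) f • mSymm ν ∈ mSpan ν := by
  refine mem_mSpan (hf.sub ((isSymmetric_mSymm ν).smul _)) fun κ _ hκs => ?_
  refine domLT_iff.mpr ⟨psum_le_psum_of_mem_support (Submodule.sub_mem _ hb
    (Submodule.smul_mem _ _ (mSymm_mem_boundedSub hν fun k => le_refl (psum ν k)))) hκs, ?_⟩
  rintro rfl
  rw [mem_support_iff, coeff_sub, coeff_smul, coeff_mSymm_self] at hκs
  simp at hκs

/-! ### Averaging over permutations -/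

/-- The sum of all permutations of `u`. -/
def symmetrize (u : Poly N) : Poly N := ∑ w : Equiv.Perm (Fin N), rename w u

/-- The alternating sum of all permutations of `u`. -/
def antisymmetrize (u : Poly N) : Poly N :=
  ∑ w : Equiv.Perm (Fin N), ((Equiv.Perm.sign w : ℤ) : ℂ) • rename w u

theorem isSymmetric_symmetrize (u : Poly N) : (symmetrize u).IsSymmetric := by
  intro v
  rw [symmetrize, map_sum]
  exact Fintype.sum_equiv (Equiv.mulLeft v) _ _ fun w => (rename_mul_perm v w u).symm

theorem sign_mul_self (v : Equiv.Perm (Fin N)) :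
    ((Equiv.Perm.sign v : ℤ) : ℂ) * ((Equiv.Perm.sign v : ℤ) : ℂ) = 1 := by
  rcases Int.units_eq_one_or (Equiv.Perm.sign v) with e | e <;> simp [e]

theorem isAntisymmetric_antisymmetrize (u : Poly N) : IsAntisymmetric (antisymmetrize u) := by
  intro v
  rw [antisymmetrize, map_sum, Finset.smul_sum]
  refine Fintype.sum_equiv (Equiv.mulLeft v) _ _ fun w => ?_
  rw [Equiv.coe_mulLeft, rename_mul_perm, map_smul, smul_smul, Equiv.Perm.sign_mul]
  push_cast
  rw [← mul_assoc, sign_mul_self, one_mul]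

theorem symmetrize_mem {p : ℕ → ℕ} {u : Poly N} (hu : u ∈ boundedSub N p) :
    symmetrize u ∈ boundedSub N p :=
  Submodule.sum_mem _ fun w _ => rename_mem_boundedSub hu w

theorem antisymmetrize_mem {p : ℕ → ℕ} {u : Poly N} (hu : u ∈ boundedSub N p) :
    antisymmetrize u ∈ boundedSub N p :=
  Submodule.sum_mem _ fun w _ => Submodule.smul_mem _ _ (rename_mem_boundedSub hu w)

theorem form_eq_zero_of_symmetrize {β : ℕ} {γ : ℝ} {f u : Poly N} (hf : f.IsSymmetric)
    (h0 : form β γ f (symmetrize u) = 0) : form β γ f u = 0 := by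
  rw [← formHom_apply, symmetrize, map_sum,
    Finset.sum_congr rfl fun (w : Equiv.Perm (Fin N)) _ => show
      formHom N β γ f (rename w u) = form β γ f u by
      rw [formHom_apply, ← form_rename β γ w f u, hf w], Finset.sum_const, nsmul_eq_mul] at h0
  refine (mul_eq_zero.mp h0).resolve_left ?_
  simp [Finset.card_univ, Fintype.card_perm, Nat.factorial_ne_zero]

theorem form_eq_zero_of_antisymmetrize {β : ℕ} {γ : ℝ} {f u : Poly N} (hf : IsAntisymmetric f)
    (h0 : form β γ f (antisymmetrize u) = 0) : form β γ f u = 0 := by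
  rw [← formHom_apply, antisymmetrize, map_sum,
    Finset.sum_congr rfl fun w _ => show
      formHom N β γ f (((Equiv.Perm.sign w : ℤ) : ℂ) • rename w u) = form β γ f u by
        rw [map_smul, ← form_rename β γ w f u, hf w, ← formHom_apply, map_smul,
          LinearMap.smul_apply], Finset.sum_const, nsmul_eq_mul] at h0
  refine (mul_eq_zero.mp h0).resolve_left ?_
  simp [Finset.card_univ, Fintype.card_perm, Nat.factorial_ne_zero]

/-! ### The shift relations -/

theorem form_succ (β : ℕ) (γ : ℝ) (f g : Poly N) :
    form (β + 1) γ f g = form β γ (vand N * f) (vand N * g) := by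
  rw [form, form, weight, weight]
  refine congrArg _ ?_
  ring

theorem addDelta_eq (lam : Fin N → ℕ) : addDelta lam = lam + staircase N := rfl

theorem antitone_addDelta {lam : Fin N → ℕ} (hlam : Antitone lam) : Antitone (addDelta lam) := by
  intro i j hij
  have h1 : lam j ≤ lam i := hlam hij
  have h2 : (i : ℕ) ≤ j := hij
  simp only [addDelta]
  omega

theorem psum_addDelta (lam : Fin N → ℕ) (k : ℕ) :
    psum (addDelta lam) k = psum lam k + psum (staircase N) k := psum_add _ _ _

theorem addDelta_injective : Function.Injective (addDelta (N := N)) := fun a b hab => by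
  rw [addDelta_eq, addDelta_eq] at hab
  exact add_right_cancel hab

theorem vand_mul_mem_addDelta_iff {lam : Fin N → ℕ} (g : Poly N) :
    vand N * g ∈ boundedSub N (psum (addDelta lam)) ↔ g ∈ boundedSub N (psum lam) := by
  rw [vand_mul_mem_iff, boundedSub, mem_restrictSupport_iff]
  simp only [psum_addDelta, add_le_add_iff_right]
  exact Iff.rfl

theorem mem_mSpan_of_lt {μ ν : Fin N → ℕ} (hμν : ∀ k, psum μ k ≤ psum ν k) (hne : μ ≠ ν)
    {g : Poly N} (hg : g.IsSymmetric) (hb : g ∈ boundedSub N (psum μ)) : g ∈ mSpan ν := by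
  refine mem_mSpan hg fun κ _ hκs => ?_
  have h1 := psum_le_psum_of_mem_support hb hκs
  refine domLT_iff.mpr ⟨fun k => (h1 k).trans (hμν k), ?_⟩
  rintro rfl
  exact hne (eq_of_psum_eq fun k => le_antisymm (hμν k) (h1 k))

/-- Reversal changes the sign of every factor of $V$. In this product form the sign can be
distributed over the factors of the constants. -/
theorem sign_revPerm : ((Equiv.Perm.sign (Fin.revPerm : Equiv.Perm (Fin N)) : ℤ) : ℂ) =
    ∏ _p ∈ Finset.univ.filter (fun p : Fin N × Fin N => p.1 < p.2), (-1 : ℂ) := by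
  have h1 : rename (Fin.revPerm : Equiv.Perm (Fin N)) (vand N) =
      (∏ _p ∈ Finset.univ.filter (fun p : Fin N × Fin N => p.1 < p.2), (-1 : ℂ)) • vand N := by
    rw [vand_eq_prod, map_prod, smul_eq_C_mul, map_prod, ← Finset.prod_mul_distrib]
    refine Finset.prod_equiv ((Equiv.prodComm _ _).trans (Fin.revPerm.prodCongr Fin.revPerm))
      (fun p => ?_) fun p _ => ?_
    · simp [Fin.rev_lt_rev]
    · simp
  rw [isAntisymmetric_vand] at h1
  exact smul_left_injective ℂ vand_ne_zero h1

theorem addDelta_rev_cast (lam : Fin N → ℕ) (i : Fin N) :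
    ((addDelta lam (Fin.rev i) : ℕ) : ℂ) = lam (Fin.rev i) + (i : ℕ) := by
  have : N - 1 - (Fin.rev i : ℕ) = i := by
    rw [Fin.val_rev]; omega
  rw [addDelta, this]
  push_cast
  rfl

theorem cConst_eq (β : ℕ) (lam : Fin N → ℕ) : cConst (β + 1) lam =
    ((Equiv.Perm.sign (Fin.revPerm : Equiv.Perm (Fin N)) : ℤ) : ℂ) *
      eval (fun j : Fin N => (expo (addDelta lam ∘ Fin.rev) j + β * (j : ℕ) : ℂ))
        (shiftPoly N β) := by
  rw [sign_revPerm, shiftPoly, map_prod, ← Finset.prod_mul_distrib, cConst]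
  refine Finset.prod_congr rfl fun p _ => ?_
  simp only [map_add, map_sub, eval_C, eval_X, expo_apply, Function.comp_apply, addDelta_rev_cast]
  push_cast
  ring

theorem cTilde_eq (β : ℕ) (lam : Fin N → ℕ) : cTilde (β + 1) lam =
    ((Equiv.Perm.sign (Fin.revPerm : Equiv.Perm (Fin N)) : ℤ) : ℂ) *
      eval (fun j : Fin N => (expo (addDelta lam ∘ Fin.rev) j + β * (j : ℕ) : ℂ))
        (shiftPoly N (-β)) := by
  rw [sign_revPerm, shiftPoly, map_prod, ← Finset.prod_mul_distrib, cTilde]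
  refine Finset.prod_congr rfl fun p _ => ?_
  simp only [map_add, map_sub, eval_C, eval_X, expo_apply, Function.comp_apply, addDelta_rev_cast]
  push_cast
  ring

/-- The quotient $g$ of $\mathcal Y_Lf$ by $V$ is symmetric, bounded by $\lambda$ and orthogonal,
for $\beta+1$, to the lower $m_\kappa$; hence it is a multiple of $q$. -/
theorem evalOp_shiftPoly_eq {γ : ℝ} (hγ : -1 / 2 < γ) (β : ℕ) {lam : Fin N → ℕ}
    (hlam : Antitone lam) {f q : Poly N} (hf : IsLaguerreSq β γ (addDelta lam) f)
    (hq : IsLaguerreSq (β + 1) γ lam q) :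
    evalOp β γ (shiftPoly N β) f = vand N * (cConst (β + 1) lam • q) := by
  have hν := antitone_addDelta hlam
  have hfb := hf.mem_boundedSub hν
  have hanti := isAntisymmetric_evalOp β γ hf.isSymmetric
  obtain ⟨g, hg⟩ := hanti.vand_dvd
  have hgs : g.IsSymmetric := isSymmetric_of_vand_mul (hg ▸ hanti)
  have hgb : g ∈ boundedSub N (psum lam) :=
    (vand_mul_mem_addDelta_iff g).mp (hg ▸ evalOp_mem β γ _ hfb)
  -- Antisymmetry moves the leading coefficient to the reversed exponent, where $\mathcal Y_L$ acts
  -- by a known scalar; symmetry of $f$ gives coefficient $1$ there.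
  have hc : coeff (expo lam) g = cConst (β + 1) lam := by
    rw [← coeff_vand_mul hgb, ← addDelta_eq, ← hg, cConst_eq]
    have h1 := hanti.coeff_expo_comp Fin.revPerm (addDelta lam)
    have h2 := (isExtremal_rev (addDelta lam)).coeff_evalOp β γ (shiftPoly N β) hfb
    have h3 := hf.isSymmetric.coeff_expo_comp Fin.revPerm (addDelta lam)
    rw [hf.coeff_eq_one hν] at h3
    have hrev : addDelta lam ∘ ⇑(Fin.revPerm : Equiv.Perm (Fin N)) = addDelta lam ∘ Fin.rev := rfl
    rw [hrev] at h1 h3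
    rw [h3, mul_one] at h2
    rw [← h2, h1, ← mul_assoc, sign_mul_self, one_mul]
  rw [hg]
  congr 1
  refine hq.unique hγ (hc ▸ sub_smul_mSymm_mem_mSpan hlam hgs hgb) fun u hu => ?_
  refine form_eq_zero_of_mSpan (fun κ hκ hκlam => ?_) hu
  rw [form_succ, ← hg, form_evalOp hγ]
  -- $\mathcal Y_L(Vm_\kappa)$ is bounded by $\kappa+\delta<\lambda+\delta$; since $f$ is symmetric
  -- it may be symmetrized, and then lies in the span orthogonal to $f$.
  refine form_eq_zero_of_symmetrize hf.isSymmetric (hf.orthogonal _ ?_)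
  refine mem_mSpan_of_lt (μ := addDelta κ) (fun k => ?_) (addDelta_injective.ne hκlam.2)
    (isSymmetric_symmetrize _) (symmetrize_mem (evalOp_mem β γ _
      ((vand_mul_mem_addDelta_iff _).mpr (mSymm_mem_boundedSub hκ fun k => le_refl (psum κ k)))))
  rw [psum_addDelta, psum_addDelta]
  exact Nat.add_le_add_right ((domLT_iff.mp hκlam).1 k) _

theorem evalOp_shiftPoly_neg_eq {γ : ℝ} (hγ : -1 / 2 < γ) (β : ℕ) {lam : Fin N → ℕ}
    (hlam : Antitone lam) {f q : Poly N} (hf : IsLaguerreSq β γ (addDelta lam) f)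
    (hq : IsLaguerreSq (β + 1) γ lam q) :
    evalOp β γ (shiftPoly N (-β)) (vand N * q) = cTilde (β + 1) lam • f := by
  have hν := antitone_addDelta hlam
  have hqb := hq.mem_boundedSub hlam
  have hVb := (vand_mul_mem_addDelta_iff q).mpr hqb
  have hanti := isAntisymmetric_vand_mul hq.isSymmetric
  have hsym := isSymmetric_evalOp β γ hanti
  have hc : coeff (expo (addDelta lam)) (evalOp β γ (shiftPoly N (-β)) (vand N * q)) =
      cTilde (β + 1) lam := by
    have h1 := hanti.coeff_expo_comp Fin.revPerm (addDelta lam)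
    have h2 := (isExtremal_rev (addDelta lam)).coeff_evalOp β γ (shiftPoly N (-β)) hVb
    have h3 := hsym.coeff_expo_comp Fin.revPerm (addDelta lam)
    have hrev : addDelta lam ∘ ⇑(Fin.revPerm : Equiv.Perm (Fin N)) = addDelta lam ∘ Fin.rev := rfl
    rw [hrev] at h1 h3
    have h4 : coeff (expo (addDelta lam)) (vand N * q) = 1 := by
      rw [addDelta_eq, coeff_vand_mul hqb, hq.coeff_eq_one hlam]
    rw [h4, mul_one] at h1
    rw [← h3, h2, h1, cTilde_eq, mul_comm]
  refine hf.unique hγ (hc ▸ sub_smul_mSymm_mem_mSpan hν hsym (evalOp_mem β γ _ hVb))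
    fun u hu => ?_
  refine form_eq_zero_of_mSpan (fun μ hμ hμν => ?_) hu
  rw [form_evalOp hγ]
  refine form_eq_zero_of_antisymmetrize hanti ?_
  have hanti' := isAntisymmetric_antisymmetrize (evalOp β γ (shiftPoly N (-β)) (mSymm μ))
  have hb := antisymmetrize_mem (evalOp_mem β γ (shiftPoly N (-β))
    (mSymm_mem_boundedSub hμ fun k => le_refl (psum μ k)))
  -- Antisymmetrizing makes division by $V$ possible. Exponents $\kappa$ of the quotient satisfy
  -- $\kappa+\delta\le\mu<\lambda+\delta$, so $\kappa<\lambda$ and the orthogonality of $q$ for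
  -- $\beta+1$ applies.
  obtain ⟨k, hk⟩ := hanti'.vand_dvd
  rw [hk] at hb hanti' ⊢
  rw [← form_succ]
  refine hq.orthogonal k (mem_mSpan (isSymmetric_of_vand_mul hanti') fun κ _ hκs => ?_)
  have h1 : ∀ i, psum (addDelta κ) i ≤ psum μ i := by
    have key : ∀ i ≤ N, psum (addDelta κ) i ≤ psum μ i := fun i hi => by
      have := (vand_mul_mem_iff k).mp hb _ hκs (Finset.univ.filter (fun j : Fin N => (j : ℕ) < i))
      rw [card_filter_val_lt hi] at this
      rw [psum_addDelta]
      exact this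
    intro i
    rcases le_total i N with hi | hi
    · exact key i hi
    · rw [psum_of_ge _ hi, psum_of_ge μ hi]
      exact key N le_rfl
  have h2 := (domLT_iff.mp hμν).1
  refine domLT_iff.mpr ⟨fun i => ?_, ?_⟩
  · have := (h1 i).trans (h2 i)
    rw [psum_addDelta, psum_addDelta] at this
    omega
  · rintro rfl
    exact hμν.2 (eq_of_psum_eq fun i => le_antisymm (h2 i) (h1 i))

theorem shiftG_eq {γ : ℝ} (hγ : -1 / 2 < γ) (β : ℕ) {lam : Fin N → ℕ} (hlam : Antitone lam)
    {P Q : Poly N} (hP : IsLaguerre β γ (addDelta lam) P) (hQ : IsLaguerre (β + 1) γ lam Q) :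
    shiftG N β γ P =
      algebraMap (Poly N) (FractionRing (Poly N)) (cConst (β + 1) lam • Q) := by
  obtain ⟨f, rfl, hf⟩ := (isLaguerre_iff hγ _ _ _).mp hP
  obtain ⟨q, rfl, hq⟩ := (isLaguerre_iff hγ _ _ _).mp hQ
  have hX : algebraMap (Poly N) (FractionRing (Poly N)) (polyX N) ≠ 0 := by
    rw [Ne, IsFractionRing.to_map_eq_zero_iff, ← expand_vand]
    exact fun h0 => vand_ne_zero (expand_injective two_pos (h0.trans (map_zero _).symm))
  rw [shiftG, opY, yProd_expand, evalOp_shiftPoly_eq hγ β hlam hf hq, map_mul, expand_vand,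
    map_mul, inv_mul_cancel_left₀ hX, map_smul]

theorem shiftGhat_eq {γ : ℝ} (hγ : -1 / 2 < γ) (β : ℕ) {lam : Fin N → ℕ} (hlam : Antitone lam)
    {P Q : Poly N} (hP : IsLaguerre β γ (addDelta lam) P) (hQ : IsLaguerre (β + 1) γ lam Q) :
    shiftGhat N β γ Q = cTilde (β + 1) lam • P := by
  obtain ⟨f, rfl, hf⟩ := (isLaguerre_iff hγ _ _ _).mp hP
  obtain ⟨q, rfl, hq⟩ := (isLaguerre_iff hγ _ _ _).mp hQ
  rw [shiftGhat, Module.End.mul_apply, mulOp, LinearMap.mulLeft_apply, ← expand_vand, ← map_mul,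
    opYhat, yProd_expand, evalOp_shiftPoly_neg_eq hγ β hlam hf hq, map_smul]

end CalogeroB

end

theorem mainTheorem10 (N : ℕ) (β : ℕ) (γ : ℝ) (hγ : -1 / 2 < γ)
    (lam : Fin N → ℕ) (hlam : Antitone lam) :
    (∃! P : CalogeroB.Poly N, CalogeroB.IsLaguerre β γ (CalogeroB.addDelta lam) P) ∧
    (∃! Q : CalogeroB.Poly N, CalogeroB.IsLaguerre (β + 1) γ lam Q) ∧
    ∀ P Q : CalogeroB.Poly N,
      CalogeroB.IsLaguerre β γ (CalogeroB.addDelta lam) P →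
      CalogeroB.IsLaguerre (β + 1) γ lam Q →
      CalogeroB.shiftG N β γ P =
          algebraMap (CalogeroB.Poly N) (FractionRing (CalogeroB.Poly N))
            (CalogeroB.cConst (β + 1) lam • Q) ∧
      CalogeroB.shiftGhat N β γ Q = CalogeroB.cTilde (β + 1) lam • P :=
  ⟨CalogeroB.existsUnique_isLaguerre hγ β _, CalogeroB.existsUnique_isLaguerre hγ (β + 1) lam,
    fun _ _ hP hQ => ⟨CalogeroB.shiftG_eq hγ β hlam hP hQ, CalogeroB.shiftGhat_eq hγ β hlam hP hQ⟩⟩
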